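/- Let $A$ be a finite-dimensional commutative associative unital $\mathbb R$-algebra (with any norm making it a normed algebra), with unit $e_0$, let $0\le q\le n$ with $n\ge 1$, and let $a^j_m\in A$ for $1\le j\le n$, $1\le m\le q$. Let $\mathrm{Vol}$ be the volume of the Euclidean unit ball of $\mathbb R^n$. Consider the $q$ Cauchy conditions $$\sum_{j=1}^n \frac{\partial f}{\partial x_j}\,a^j_m=0,\qquad m=1,\dots,q. \tag{C}$$ Let $D_0=\det(a^j_m)_{1\le j,m\le q}$, and for $1\le k\le n-q$, $1\le m\le q$ let $D^k_m$ be the determinant of the $q\times q$ matrix obtained from the rows $1,\dots,q,q+k$ (in this order) of the matrix $(a^j_m)$ by deleting the row $m$. Suppose that $D_0$ is invertible in $A$ and that the conditions $$(A):\qquad \sum_{m=1}^q D^l_mD^k_m+\delta^l_kD_0^2=0,\qquad 1\le k,l\le n-q,$$ hold. Call a family $(c^j_i)_{1\le i,j\le q}$ in $A$ admissible if $c^i_i=e_0/n$ for all $i$ and $c^j_i+c^i_j=0$ for $i\ne j$. Extend such a family to $1\le i,j\le n$ by $$c^{q+k}_i=D_0^{-1}\sum_{m=1}^q(-1)^{q+m}D^k_mc^m_i,\qquad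 c^i_{q+k}=-c^{q+k}_i\qquad (i\le q),$$ $$c^{q+l}_{q+k}=D_0^{-1}\sum_{m=1}^q(-1)^{q+m}D^l_mc^m_{q+k}\qquad(1\le k,l\le n-q),$$ and put, for $1\le i\le n$, $1\le m\le q$, $$b^i_m=\frac{1}{\mathrm{Vol}}\,D_0^{-1}\,\widetilde{D^i_m},$$ where $\widetilde{D^i_m}$ is obtained from $D_0$ by replacing the column $m$ by $(c^1_i,\dots,c^q_i)$. Let $\varphi_m(x,y)=\sum_{i=1}^nb^i_m(y_i-x_i)$. Then: 1. Admissible families exist. 2. A family $(b^i_m)$ in $A$ satisfies the system $$\sum_{m=1}^qa^j_mb^j_m=\frac{e_0}{n\,\mathrm{Vol}}\ (1\le j\le n),\qquad \sum_{m=1}^q\big(a^j_mb^i_m+a^i_mb^j_m\big)=0\ (i\ne j)$$ if and only if it is given by the formula above for some admissible family $(c^j_i)$. 3. For every admissible family, the extended family satisfies $c^i_i=e_0/n$ and $c^j_i+c^i_j=0$ ($i\ne j$) for all $1\le i,j\le n$, and $\sum_{m}a^j_mb^i_m=c^j_i/\mathrm{Vol}$ for all $1\le i,j\le n$; and for every bounded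 open set $D\subset\mathbb R^n$ (connected or not) with $C^\infty$ boundary, every $f:\overline D\to A$ of class $C^1$ on $\overline D$ satisfying (C) in $D$, and every $x\in D$, one has the Cauchy formula $$f(x)=\int_{\partial D}f(y)\sum_{m=1}^q\Big(\sum_{j=1}^na^j_m\frac{\partial}{\partial y_j}\Big)\lrcorner\Big(\frac{\varphi_m(x,y)}{\|y-x\|^n}\,dV\Big) =\int_{\partial D}f(y)\sum_{m=1}^q\sum_{j=1}^n a^j_m\,\frac{\varphi_m(x,y)}{\|y-x\|^n}\,\nu_j(y)\,d\sigma(y),$$ where $\|\cdot\|$ is the Euclidean norm, $dV=dy_1\wedge\dots\wedge dy_n$, $\nu$ is the outward unit normal and $\sigma$ the surface measure of $\partial D$; the integrand is $\sigma$-integrable. -/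

import Mathlib

open MeasureTheory
open scoped ContDiff BigOperators

noncomputable section

namespace CauchyAlgebra

/-! ### Open sets with smooth boundary, outward normal, boundary integral -/

/-- `ρ` is a smooth defining function of the open set `D` on the open set `U`: on `U` it is
`C^∞` with nowhere vanishing gradient, and `D ∩ U` is the set where `ρ < 0`. -/
structure IsDefiningFunction {n : ℕ} (D U : Set (EuclideanSpace ℝ (Fin n)))
    (ρ : EuclideanSpace ℝ (Fin n) → ℝ) : Prop where
  isOpen : IsOpen U
  contDiffOn : ContDiffOn ℝ ∞ ρ U
  gradient_ne_zero : ∀ y ∈ U, gradient ρ y ≠ 0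
  mem_iff : ∀ y ∈ U, y ∈ D ↔ ρ y < 0

/-- `D` has a smooth boundary: near each boundary point it lies on one side of a smooth
hypersurface. -/
def HasSmoothBoundary {n : ℕ} (D : Set (EuclideanSpace ℝ (Fin n))) : Prop :=
  ∀ p ∈ frontier D, ∃ U ρ, p ∈ U ∧ IsDefiningFunction D U ρ

/-- `v` is the outward unit normal to `∂D` at `p`: the normalized gradient of a smooth
defining function of `D` near `p`. -/
def IsOutwardUnitNormal {n : ℕ} (D : Set (EuclideanSpace ℝ (Fin n)))
    (p v : EuclideanSpace ℝ (Fin n)) : Prop :=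
  ∃ U ρ, p ∈ U ∧ IsDefiningFunction D U ρ ∧ v = ‖gradient ρ p‖⁻¹ • gradient ρ p

/-- The outward unit normal field along `∂D`. -/
def outwardUnitNormal {n : ℕ} (D : Set (EuclideanSpace ℝ (Fin n)))
    (p : EuclideanSpace ℝ (Fin n)) : EuclideanSpace ℝ (Fin n) :=
  Classical.epsilon (IsOutwardUnitNormal D p)

theorem isOutwardUnitNormal_outwardUnitNormal {n : ℕ} {D : Set (EuclideanSpace ℝ (Fin n))}
    (hD : HasSmoothBoundary D) {p : EuclideanSpace ℝ (Fin n)} (hp : p ∈ frontier D) :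
    IsOutwardUnitNormal D p (outwardUnitNormal D p) := by
  obtain ⟨U, ρ, hpU, h⟩ := hD p hp
  exact Classical.epsilon_spec (p := IsOutwardUnitNormal D p) ⟨_, U, ρ, hpU, h, rfl⟩

/-- The outward unit normal does not depend on the defining function. -/
theorem IsOutwardUnitNormal.unique {n : ℕ} {D : Set (EuclideanSpace ℝ (Fin n))}
    {p v w : EuclideanSpace ℝ (Fin n)} (hp : p ∈ frontier D)
    (hv : IsOutwardUnitNormal D p v) (hw : IsOutwardUnitNormal D p w) : v = w := by
  obtain ⟨U, ρ, hpU, h, rfl⟩ := hv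
  obtain ⟨V, σ, hpV, k, rfl⟩ := hw
  have key : ∀ {U : Set (EuclideanSpace ℝ (Fin n))} {ρ : EuclideanSpace ℝ (Fin n) → ℝ},
      p ∈ U → IsDefiningFunction D U ρ → ρ p = 0 ∧ HasFDerivAt ρ (fderiv ℝ ρ p) p := by
    intro U ρ hpU h
    have hd : DifferentiableAt ℝ ρ p :=
      ((h.contDiffOn.contDiffAt (h.isOpen.mem_nhds hpU)).differentiableAt (by simp))
    refine ⟨le_antisymm ?_ ?_, hd.hasFDerivAt⟩
    · by_contra! hpos
      have hev : ∀ᶠ y in nhds p, 0 < ρ y ∧ y ∈ U :=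
        (hd.continuousAt.eventually_const_lt hpos).and (h.isOpen.mem_nhds hpU)
      obtain ⟨y, ⟨hy, hyU⟩, hyD⟩ := mem_closure_iff_nhds.1 hp.1 _ hev
      exact absurd ((h.mem_iff y hyU).1 hyD) hy.not_gt
    · by_contra! hneg
      have hev : ∀ᶠ y in nhds p, ρ y < 0 ∧ y ∈ U :=
        (hd.continuousAt.eventually_lt_const hneg).and (h.isOpen.mem_nhds hpU)
      refine hp.2 (mem_interior_iff_mem_nhds.2 ?_)
      filter_upwards [hev] with y hy
      exact (h.mem_iff y hy.2).2 hy.1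
  obtain ⟨hρ0, hρ⟩ := key hpU h
  obtain ⟨hσ0, hσ⟩ := key hpV k
  have hg := h.gradient_ne_zero p hpU
  have kg := k.gradient_ne_zero p hpV
  set u := ‖gradient ρ p‖⁻¹ • gradient ρ p with hu
  set v := ‖gradient σ p‖⁻¹ • gradient σ p with hv
  have hu1 : ‖u‖ = 1 := by
    rw [hu, norm_smul, norm_inv, norm_norm, inv_mul_cancel₀ (norm_ne_zero_iff.2 hg)]
  have hv1 : ‖v‖ = 1 := by
    rw [hv, norm_smul, norm_inv, norm_norm, inv_mul_cancel₀ (norm_ne_zero_iff.2 kg)]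
  by_contra hne
  have hlt : inner ℝ u v < 1 := (inner_lt_one_iff_real_of_norm_eq_one hu1 hv1).2 hne
  have hfd : ∀ {ρ : EuclideanSpace ℝ (Fin n) → ℝ} {z : EuclideanSpace ℝ (Fin n)},
      gradient ρ p ≠ 0 →
      fderiv ℝ ρ p z = ‖gradient ρ p‖ * inner ℝ (‖gradient ρ p‖⁻¹ • gradient ρ p) z := by
    intro ρ z hz
    rw [real_inner_smul_left, mul_inv_cancel_left₀ (norm_ne_zero_iff.2 hz), gradient,
      InnerProductSpace.toDual_symm_apply]
  -- along the direction `v - u` the first function decreases and the second one increases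
  have hline : ∀ {ρ : EuclideanSpace ℝ (Fin n) → ℝ}, HasFDerivAt ρ (fderiv ℝ ρ p) p →
      HasDerivAt (fun t : ℝ => ρ (p + t • (v - u))) (fderiv ℝ ρ p (v - u)) 0 := by
    intro ρ hρ
    have h1 : HasDerivAt (fun t : ℝ => p + t • (v - u)) (v - u) 0 := by
      simpa using ((hasDerivAt_id (0 : ℝ)).smul_const (v - u)).const_add p
    have h2 : HasFDerivAt ρ (fderiv ℝ ρ p) (p + (0 : ℝ) • (v - u)) := by simpa using hρ
    exact h2.comp_hasDerivAt 0 h1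
  have e1 : fderiv ℝ ρ p (v - u) < 0 := by
    rw [hfd hg, ← hu, inner_sub_right, real_inner_self_eq_norm_sq, hu1]
    exact mul_neg_of_pos_of_neg (norm_pos_iff.2 hg) (by linarith)
  have e2 : 0 < fderiv ℝ σ p (v - u) := by
    rw [hfd kg, ← hv, inner_sub_right, real_inner_self_eq_norm_sq, hv1, real_inner_comm]
    exact mul_pos (norm_pos_iff.2 kg) (by linarith)
  have hcont : Filter.Tendsto (fun t : ℝ => p + t • (v - u)) (nhdsWithin 0 (Set.Ioi 0))
      (nhds p) := by
    have : Continuous fun t : ℝ => p + t • (v - u) := by fun_prop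
    simpa using (this.tendsto 0).mono_left nhdsWithin_le_nhds
  have t1 := (hasDerivWithinAt_iff_tendsto_slope' (by simp)).1
    ((hline hρ).hasDerivWithinAt (s := Set.Ioi 0))
  have t2 := (hasDerivWithinAt_iff_tendsto_slope' (by simp)).1
    ((hline hσ).hasDerivWithinAt (s := Set.Ioi 0))
  have hev := ((((t1.eventually_lt_const e1).and (t2.eventually_const_lt e2)).and
    (hcont.eventually (h.isOpen.mem_nhds hpU))).and
    (hcont.eventually (k.isOpen.mem_nhds hpV))).and self_mem_nhdsWithin
  obtain ⟨t, ⟨⟨⟨h1, h2⟩, h3⟩, h4⟩, ht⟩ := hev.exists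
  have ht' : (0 : ℝ) < t := ht
  simp only [slope_def_field, zero_smul, add_zero, hρ0, hσ0, sub_zero] at h1 h2
  have h1' : ρ (p + t • (v - u)) < 0 := by
    by_contra! hc
    exact absurd (div_nonneg hc ht'.le) h1.not_ge
  have h2' : 0 < σ (p + t • (v - u)) := by
    by_contra! hc
    exact absurd (div_nonpos_of_nonpos_of_nonneg hc ht'.le) h2.not_ge
  exact absurd ((k.mem_iff _ h4).1 ((h.mem_iff _ h3).2 h1')) h2'.not_gt

/-- The integrand, with respect to the surface measure of `∂D`, of the form
`∑ j, X j ∂/∂y_j ⌟ dV = ∑ j, (-1)^(j-1) X j dy_1 ∧ ⋯ (no dy_j) ⋯ ∧ dy_n` restricted to `∂D`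
(oriented as the boundary of `D`), that is `∑ j, ν_j X_j`. -/
def boundaryFlux {n : ℕ} {A : Type*} [NormedCommRing A] [NormedAlgebra ℝ A]
    (D : Set (EuclideanSpace ℝ (Fin n))) (X : EuclideanSpace ℝ (Fin n) → Fin n → A)
    (y : EuclideanSpace ℝ (Fin n)) : A :=
  ∑ j, outwardUnitNormal D y j • X y j

/-- The surface measure of `∂D`: the Euclidean (normalized) `(n-1)`-dimensional Hausdorff
measure restricted to the boundary. -/
def surfaceMeasure {n : ℕ} (D : Set (EuclideanSpace ℝ (Fin n))) :
    Measure (EuclideanSpace ℝ (Fin n)) :=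
  (Measure.euclideanHausdorffMeasure (n - 1)).restrict (frontier D)

/-! ### Cauchy conditions -/

/-- `f` satisfies on `D` the `q` Cauchy conditions `∑ j, ∂f/∂x_j * a j m = 0`. -/
def SatisfiesCauchyConditions {n q : ℕ} {A : Type*} [NormedCommRing A] [NormedAlgebra ℝ A]
    (a : Matrix (Fin n) (Fin q) A) (D : Set (EuclideanSpace ℝ (Fin n)))
    (f : EuclideanSpace ℝ (Fin n) → A) : Prop :=
  ∀ m, ∀ x ∈ D, ∑ j, fderiv ℝ f x (EuclideanSpace.single j 1) * a j m = 0

/-- The volume of the unit ball of `ℝⁿ`. -/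
def ballVol (n : ℕ) : ℝ :=
  volume.real (Metric.ball (0 : EuclideanSpace ℝ (Fin n)) 1)

/-- The linear forms `φ_m(x, y) = ∑ i, b i m (y_i - x_i)`. -/
def kernelNumerator {n q : ℕ} {A : Type*} [NormedCommRing A] [NormedAlgebra ℝ A]
    (b : Matrix (Fin n) (Fin q) A) (m : Fin q) (x y : EuclideanSpace ℝ (Fin n)) : A :=
  ∑ i, (y i - x i) • b i m

/-- The components, in `∂/∂y_j`, of the vector field
`∑ m, (∑ j, a j m ∂/∂y_j) f(y) φ_m(x, y) / ‖y - x‖ⁿ`. -/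
def cauchyField {n q : ℕ} {A : Type*} [NormedCommRing A] [NormedAlgebra ℝ A]
    (a b : Matrix (Fin n) (Fin q) A) (f : EuclideanSpace ℝ (Fin n) → A)
    (x y : EuclideanSpace ℝ (Fin n)) (j : Fin n) : A :=
  f y * ∑ m, a j m * ((‖y - x‖ ^ n)⁻¹ • kernelNumerator b m x y)

/-- The linear system for the coefficients of the kernel. -/
def SolvesKernelSystem {n q : ℕ} {A : Type*} [NormedCommRing A] [NormedAlgebra ℝ A]
    (a b : Matrix (Fin n) (Fin q) A) : Prop :=
  (∀ j, ∑ m, a j m * b j m = ((n : ℝ) * ballVol n)⁻¹ • (1 : A)) ∧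
  ∀ i j, i ≠ j → ∑ m, (a j m * b i m + a i m * b j m) = 0

/-! ### The determinants and conditions (A); here `n = q + r` -/

/-- The square matrix of the first `q` rows of `a`. -/
def mainBlock {q r : ℕ} {A : Type*} (a : Matrix (Fin (q + r)) (Fin q) A) :
    Matrix (Fin q) (Fin q) A :=
  a.submatrix (Fin.castAdd r) id

/-- `D₀`. -/
def detMain {q r : ℕ} {A : Type*} [CommRing A] (a : Matrix (Fin (q + r)) (Fin q) A) : A :=
  (mainBlock a).det

/-- `D^k_m`: from the `q + 1` rows number `1, …, q, q + k` of `a` (in this order) the row `m` is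
deleted, and the determinant is taken. -/
def detExchange {q r : ℕ} {A : Type*} [CommRing A] (a : Matrix (Fin (q + r)) (Fin q) A)
    (k : Fin r) (m : Fin q) : A :=
  (a.submatrix
    (fun s => Fin.snoc (α := fun _ => Fin (q + r)) (Fin.castAdd r) (Fin.natAdd q k)
      (m.castSucc.succAbove s)) id).det

/-- The conditions (A). -/
def ConditionA {q r : ℕ} {A : Type*} [CommRing A] (a : Matrix (Fin (q + r)) (Fin q) A) : Prop :=
  ∀ k l : Fin r, ∑ m, detExchange a l m * detExchange a k m
    + (if l = k then 1 else 0) * detMain a ^ 2 = 0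

/-- Admissible choices of the coefficients `c^j_i = c j i`, `1 ≤ i, j ≤ q`. -/
def IsAdmissible {q : ℕ} (n : ℕ) {A : Type*} [CommRing A] [Algebra ℝ A]
    (c : Matrix (Fin q) (Fin q) A) : Prop :=
  (∀ i, c i i = (n : ℝ)⁻¹ • (1 : A)) ∧ ∀ i j, i ≠ j → c j i + c i j = 0

/-- `c^{q+k}_i = D₀⁻¹ ∑ m, (-1)^(q+m) D^k_m c^m_i` for a column `c_i = (c^1_i, …, c^q_i)`. The
index `m` below starts at `0`, whence the sign `(-1)^(q+m+1)`. -/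
def lowerEntry {q r : ℕ} {A : Type*} [CommRing A] (a : Matrix (Fin (q + r)) (Fin q) A)
    (col : Fin q → A) (k : Fin r) : A :=
  Ring.inverse (detMain a) * ∑ m : Fin q, (-1) ^ (q + (m : ℕ) + 1) * detExchange a k m * col m

/-- The coefficients `c^l_i` for `1 ≤ l ≤ q` and all `i ≤ n`: for `i = q + k` they are
`c^l_{q+k} = - c^{q+k}_l`. -/
def topColumn {q r : ℕ} {A : Type*} [CommRing A] (a : Matrix (Fin (q + r)) (Fin q) A)
    (c : Matrix (Fin q) (Fin q) A) (i : Fin (q + r)) : Fin q → A :=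
  Fin.addCases (fun i' l => c l i') (fun k l => - lowerEntry a (fun m => c m l) k) i

/-- All the coefficients `c^j_i = extendedCoeff a c j i`, `1 ≤ i, j ≤ n`. -/
def extendedCoeff {q r : ℕ} {A : Type*} [CommRing A] (a : Matrix (Fin (q + r)) (Fin q) A)
    (c : Matrix (Fin q) (Fin q) A) : Matrix (Fin (q + r)) (Fin (q + r)) A :=
  fun j i => Fin.addCases (fun l => topColumn a c i l)
    (fun k => lowerEntry a (topColumn a c i) k) j

/-- Cramer's formula `b^i_m = Vol(B(0,1))⁻¹ D₀⁻¹ D^i_m~`, where `D^i_m~` comes from `D₀` by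
replacing the column `m` by `(c^1_i, …, c^q_i)`. -/
def cramerCoeff {q r : ℕ} {A : Type*} [CommRing A] [Algebra ℝ A]
    (a : Matrix (Fin (q + r)) (Fin q) A) (c : Matrix (Fin q) (Fin q) A) :
    Matrix (Fin (q + r)) (Fin q) A :=
  fun i m => (ballVol (q + r))⁻¹ • (Ring.inverse (detMain a) *
    ((mainBlock a).updateCol m (fun l => extendedCoeff a c (Fin.castAdd r l) i)).det)

end CauchyAlgebra

end

/-!
The Cauchy formula is the divergence theorem for the field
`X j = f(y) ∑ m, a j m φ_m(x, y) / ‖y - x‖ⁿ`, whose divergence vanishes off `x`.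

*Coefficients.* Let `M` be the block of the first `q` rows of `a`, `N` the block of the last `r`
ones, and `T = N M⁻¹` (`transferMatrix`). By Cramer's rule and a cyclic permutation of the rows the
entries of `T` are `±D₀⁻¹ D^k_m`, so `lowerEntry` is multiplication by `T` (`lowerEntry_eq`) and
condition (A) says that `T Tᵀ = -1`. The extended matrix has the blocks `c`, `T c`, `-(T c)ᵀ` and
`-T cᵀ Tᵀ`; its symmetric part is therefore `1 / n` as soon as that of `c` is. Conversely, a
solution `b` of the kernel system is determined by the leading block of `Vol • a bᵀ`.

*The divergence theorem.* Mathlib has no surface integration over smooth boundaries; the theorem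
`integral_divergence_eq_integral_flux` is proved for the Hausdorff surface measure without the area
formula. Near a boundary point `p` with normal `ν`, let `v = ν + w` with `w` orthogonal to `ν`. In
the volume-preserving coordinates `(t, y) ↦ t v + y`, `y ∈ ν^⊥`, the domain is `{t < g y}`, and
Fubini's theorem gives `∫_D ∂_v u = ∫ u(g y, y) dy` exactly. The boundary chords near `p` are almost
orthogonal to `ν`, by strict differentiability of a defining function, so the oblique projection of
the boundary onto `ν^⊥` is bi-Lipschitz with constants close to `1`; hence `dy` and the surface
measure agree up to a factor close to `1` (`exists_local_flux_estimate`). Every vector is a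
combination of two such `v`, and the normal is continuous, so the divergence theorem holds locally
up to `ε ∫ ‖u‖ dσ`. A partition of unity adds up these errors to `ε ∫ ‖u‖ dσ` for every `u`
(`fluxDefect_eq_zero`).

*The pole.* Replacing `‖y - x‖⁻ⁿ` by `(‖y - x‖² + s)^(-n/2)` makes the field smooth, and since the
symmetric part of the coefficients `∑ m, a j m b i m` is scalar its divergence is
`Vol⁻¹ s (‖y - x‖² + s)^(-n/2-1) f(y)` (`divergence_regularizedField`), an approximate identity
applied to `f`. The formula follows as `s → 0`.
-/

namespace CauchyAlgebra

/-! ### The linear algebra of the kernel coefficients -/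

section Coefficients

open Matrix

variable {A : Type*} {q r : ℕ}

/-- The rows `q + 1, …, q + r` of `a`. -/
def lowerBlock (a : Matrix (Fin (q + r)) (Fin q) A) : Matrix (Fin r) (Fin q) A :=
  a.submatrix (Fin.natAdd q) id

variable [CommRing A]

/-- The matrix `T` expressing the last `r` rows of `a` through the first `q` ones. -/
noncomputable def transferMatrix (a : Matrix (Fin (q + r)) (Fin q) A) : Matrix (Fin r) (Fin q) A :=
  lowerBlock a * (mainBlock a)⁻¹

/-- Up to the sign of a cycle, `D^k_m` is `D₀` with its row `m` replaced by the row `q + k`. -/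
theorem detExchange_eq (a : Matrix (Fin (q + r)) (Fin q) A) (k : Fin r) (m : Fin q) :
    (-1) ^ (q + (m : ℕ) + 1) * detExchange a k m
      = ((mainBlock a).updateRow m (lowerBlock a k)).det := by
  obtain _ | p := q
  · exact m.elim0
  -- the row `m` of the updated matrix is moved to the bottom by a cycle
  have hE : (a.submatrix (fun s => Fin.snoc (α := fun _ => Fin (p + 1 + r)) (Fin.castAdd r)
      (Fin.natAdd (p + 1) k) (m.castSucc.succAbove s)) id)
      = ((mainBlock a).updateRow m (lowerBlock a k)).submatrix
        (Fin.cycleIcc m (Fin.last p)) id := by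
    ext s j
    simp only [submatrix_apply, id]
    rcases lt_or_ge s m with hs | hs
    · rw [Fin.cycleIcc_of_lt hs, updateRow_ne hs.ne,
        Fin.succAbove_of_castSucc_lt _ _ (by simpa using hs), Fin.snoc_castSucc]
      rfl
    · rw [Fin.succAbove_of_le_castSucc _ _ (by simpa using hs)]
      rcases (Fin.le_last s).lt_or_eq with hl | rfl
      · have hsucc : s.succ = (s + 1).castSucc := by
          ext; simp [Fin.val_add_one_of_lt hl]
        have hne : s + 1 ≠ m := by
          intro h
          have := congrArg Fin.val h
          rw [Fin.val_add_one_of_lt hl] at this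
          have := Fin.le_def.1 hs
          omega
        rw [Fin.cycleIcc_of_ge_of_lt hs hl, updateRow_ne hne, hsucc, Fin.snoc_castSucc]
        rfl
      · rw [Fin.cycleIcc_of_last hs, updateRow_self, Fin.succ_last, Fin.snoc_last]
        rfl
  rw [detExchange, hE, det_permute, Fin.sign_cycleIcc_of_le (Fin.le_last m), ← mul_assoc]
  have hm : (m : ℕ) ≤ p := Nat.lt_succ_iff.1 m.2
  have : ((-1 : A) ^ (p + 1 + (m : ℕ) + 1))
      * (((-1 : ℤˣ) ^ ((Fin.last p : ℕ) - m) : ℤˣ) : ℤ) = 1 := by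
    push_cast
    rw [← pow_add, show p + 1 + (m : ℕ) + 1 + (p - (m : ℕ)) = 2 * (p + 1) by omega, pow_mul]
    simp
  rw [this, one_mul]

/-- The coefficients of `lowerEntry` are the entries of the transfer matrix, by Cramer's rule. -/
theorem inverse_mul_detExchange (a : Matrix (Fin (q + r)) (Fin q) A) (k : Fin r) (m : Fin q) :
    Ring.inverse (detMain a) * ((-1) ^ (q + (m : ℕ) + 1) * detExchange a k m)
      = transferMatrix a k m := by
  rw [detExchange_eq, ← cramer_transpose_apply, cramer_eq_adjugate_mulVec, ← adjugate_transpose,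
    transferMatrix, inv_def, Matrix.mul_smul, Matrix.smul_apply, smul_eq_mul, detMain,
    mulVec_transpose]
  rfl

theorem lowerEntry_eq (a : Matrix (Fin (q + r)) (Fin q) A) (col : Fin q → A) (k : Fin r) :
    lowerEntry a col k = (transferMatrix a *ᵥ col) k := by
  simp only [lowerEntry, mulVec, dotProduct, ← inverse_mul_detExchange, Finset.mul_sum, mul_assoc]

variable {a : Matrix (Fin (q + r)) (Fin q) A}

/-- Condition (A) says that `T Tᵀ = -1`. -/
theorem ConditionA.transferMatrix_mul_transpose (hA : ConditionA a) (hD : IsUnit (detMain a)) :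
    transferMatrix a * (transferMatrix a)ᵀ = -1 := by
  ext l k
  have hsq : ∀ m : Fin q, ((-1 : A) ^ (q + (m : ℕ) + 1)) * (-1) ^ (q + (m : ℕ) + 1) = 1 := by
    intro m; rw [← mul_pow]; simp
  have h1 : (transferMatrix a * (transferMatrix a)ᵀ) l k
      = Ring.inverse (detMain a) ^ 2 * ∑ m, detExchange a l m * detExchange a k m := by
    simp only [mul_apply, transpose_apply, ← inverse_mul_detExchange, Finset.mul_sum]
    refine Finset.sum_congr rfl fun m _ => ?_
    linear_combination (Ring.inverse (detMain a) ^ 2 * (detExchange a l m * detExchange a k m))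
      * hsq m
  have h2 : Ring.inverse (detMain a) * detMain a = 1 := Ring.inverse_mul_cancel _ hD
  have h3 : (if l = k then (1 : A) else 0) = (1 : Matrix (Fin r) (Fin r) A) l k := by
    rw [one_apply]
  have h4 := hA k l
  rw [h3] at h4
  rw [h1, neg_apply]
  linear_combination Ring.inverse (detMain a) ^ 2 * h4
    - (1 : Matrix (Fin r) (Fin r) A) l k * (Ring.inverse (detMain a) * detMain a + 1) * h2

theorem transferMatrix_mul_mainBlock (hD : IsUnit (detMain a)) :
    transferMatrix a * mainBlock a = lowerBlock a := by
  rw [transferMatrix, Matrix.mul_assoc, nonsing_inv_mul _ hD, Matrix.mul_one]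

@[simp] theorem extendedCoeff_castAdd (c : Matrix (Fin q) (Fin q) A) (l : Fin q)
    (i : Fin (q + r)) : extendedCoeff a c (Fin.castAdd r l) i = topColumn a c i l := by
  simp [extendedCoeff]

theorem extendedCoeff_natAdd (c : Matrix (Fin q) (Fin q) A) (k : Fin r)
    (i : Fin (q + r)) :
    extendedCoeff a c (Fin.natAdd q k) i = (transferMatrix a *ᵥ topColumn a c i) k := by
  simp [extendedCoeff, lowerEntry_eq]

@[simp] theorem topColumn_castAdd (c : Matrix (Fin q) (Fin q) A) (i l : Fin q) :
    topColumn a c (Fin.castAdd r i) l = c l i := by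
  simp [topColumn]

theorem topColumn_natAdd (c : Matrix (Fin q) (Fin q) A) (k : Fin r) (l : Fin q) :
    topColumn a c (Fin.natAdd q k) l = -(transferMatrix a * c) k l := by
  simp [topColumn, lowerEntry_eq]
  rfl

variable [Algebra ℝ A] {n : ℕ}

/-- Admissibility is one matrix identity, since `2` is invertible. -/
theorem isAdmissible_iff {p : ℕ} {c : Matrix (Fin p) (Fin p) A} :
    IsAdmissible n c ↔
      ∀ i j, c j i + c i j = (2 * (n : ℝ)⁻¹) • (1 : Matrix (Fin p) (Fin p) A) j i := by
  constructor
  · rintro ⟨h1, h2⟩ i j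
    by_cases h : i = j
    · subst h
      rw [h1, one_apply_eq, ← add_smul, two_mul]
    · rw [h2 i j h, one_apply_ne (Ne.symm h), smul_zero]
  · intro h
    refine ⟨fun i => ?_, fun i j hij => ?_⟩
    · have := h i i
      rw [one_apply_eq, ← two_smul ℝ, mul_smul] at this
      exact smul_right_injective A (two_ne_zero (α := ℝ)) this
    · rw [h i j, one_apply_ne (Ne.symm hij), smul_zero]

theorem isAdmissible_scalar (n q : ℕ) :
    IsAdmissible n ((n : ℝ)⁻¹ • (1 : Matrix (Fin q) (Fin q) A)) := by
  refine ⟨fun i => by simp, fun i j hij => by simp [hij, hij.symm]⟩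

/-- The extended matrix has the blocks `c`, `T c`, `-(T c)ᵀ` and `-T cᵀ Tᵀ`; the last one has
symmetric part `1 / n` because `T Tᵀ = -1`. -/
theorem IsAdmissible.extendedCoeff (hA : ConditionA a) (hD : IsUnit (detMain a))
    {c : Matrix (Fin q) (Fin q) A} (hc : IsAdmissible n c) :
    IsAdmissible n (extendedCoeff a c) := by
  rw [isAdmissible_iff] at hc ⊢
  have hmat : c + cᵀ = (2 * (n : ℝ)⁻¹) • (1 : Matrix (Fin q) (Fin q) A) := by
    ext j i; simpa using hc i j
  have hTT := hA.transferMatrix_mul_transpose hD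
  have lowerLeft : ∀ (k : Fin r) (i : Fin q), CauchyAlgebra.extendedCoeff a c (Fin.natAdd q k)
      (Fin.castAdd r i) = (transferMatrix a * c) k i := by
    intro k i
    rw [extendedCoeff_natAdd]
    simp [mulVec, dotProduct, mul_apply]
  have lowerRight : ∀ k l : Fin r, CauchyAlgebra.extendedCoeff a c (Fin.natAdd q k)
      (Fin.natAdd q l) = -(transferMatrix a * cᵀ * (transferMatrix a)ᵀ) k l := by
    intro k l
    rw [extendedCoeff_natAdd, Matrix.mul_assoc, ← transpose_mul]
    simp [mulVec, dotProduct, mul_apply, topColumn_natAdd, mul_comm]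
  have hsum : transferMatrix a * cᵀ * (transferMatrix a)ᵀ
      + (transferMatrix a * cᵀ * (transferMatrix a)ᵀ)ᵀ
      = -((2 * (n : ℝ)⁻¹) • (1 : Matrix (Fin r) (Fin r) A)) := by
    rw [transpose_mul, transpose_mul, transpose_transpose, transpose_transpose, ← Matrix.mul_assoc,
      ← Matrix.add_mul, ← Matrix.mul_add, add_comm, hmat, Matrix.mul_smul, Matrix.mul_one,
      Matrix.smul_mul, hTT, smul_neg]
  intro i j
  refine Fin.addCases (fun i => ?_) (fun k => ?_) i <;>
    refine Fin.addCases (fun j => ?_) (fun l => ?_) j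
  · rw [extendedCoeff_castAdd, extendedCoeff_castAdd, topColumn_castAdd, topColumn_castAdd, hc i j]
    simp [one_apply]
  · rw [extendedCoeff_castAdd, topColumn_natAdd, lowerLeft]
    simp [one_apply, Fin.ext_iff]
    omega
  · rw [extendedCoeff_castAdd, topColumn_natAdd, lowerLeft]
    simp [one_apply, Fin.ext_iff]
    omega
  · have := congrFun (congrFun hsum l) k
    rw [lowerRight, lowerRight]
    simp only [Matrix.add_apply, Matrix.neg_apply, Matrix.smul_apply, transpose_apply] at this
    rw [← neg_add, this, neg_neg]
    simp [one_apply]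

theorem cramerCoeff_eq (c : Matrix (Fin q) (Fin q) A) (i : Fin (q + r)) :
    cramerCoeff a c i = (ballVol (q + r))⁻¹ • ((mainBlock a)⁻¹ *ᵥ topColumn a c i) := by
  ext m
  rw [cramerCoeff]
  simp only [extendedCoeff_castAdd]
  rw [← cramer_apply, cramer_eq_adjugate_mulVec, inv_def, smul_mulVec, Pi.smul_apply,
    Pi.smul_apply, smul_eq_mul, detMain]

/-- The system `∑ m, a^j_m b^i_m = c^j_i / Vol` is solved by Cramer's formula. -/
theorem sum_mul_cramerCoeff (hD : IsUnit (detMain a)) (c : Matrix (Fin q) (Fin q) A)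
    (i j : Fin (q + r)) :
    ∑ m, a j m * cramerCoeff a c i m = (ballVol (q + r))⁻¹ • extendedCoeff a c j i := by
  have hM : mainBlock a *ᵥ cramerCoeff a c i = (ballVol (q + r))⁻¹ • topColumn a c i := by
    rw [cramerCoeff_eq, mulVec_smul, mulVec_mulVec, mul_nonsing_inv _ hD, one_mulVec]
  refine Fin.addCases (fun j => ?_) (fun k => ?_) j
  · rw [extendedCoeff_castAdd]
    exact congrFun hM j
  · have : lowerBlock a *ᵥ cramerCoeff a c i
        = (ballVol (q + r))⁻¹ • (transferMatrix a *ᵥ topColumn a c i) := by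
      rw [← transferMatrix_mul_mainBlock hD, ← mulVec_mulVec, hM, mulVec_smul]
    rw [extendedCoeff_natAdd]
    exact congrFun this k

end Coefficients

theorem ballVol_pos (n : ℕ) : 0 < ballVol n :=
  ENNReal.toReal_pos (Metric.measure_ball_pos volume _ one_pos).ne'
    Metric.isBounded_ball.measure_lt_top.ne

section KernelSystem

open Matrix

variable {A : Type*} [NormedCommRing A] [NormedAlgebra ℝ A] {q r : ℕ}
  {a : Matrix (Fin (q + r)) (Fin q) A}

/-- The kernel system says that `Vol • a bᵀ` is admissible. -/
theorem solvesKernelSystem_iff_isAdmissible {n : ℕ} {a b : Matrix (Fin n) (Fin q) A} :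
    SolvesKernelSystem a b ↔ IsAdmissible n (ballVol n • (a * bᵀ)) := by
  have hV := (ballVol_pos n).ne'
  simp only [SolvesKernelSystem, IsAdmissible, Matrix.smul_apply, mul_apply, transpose_apply,
    Finset.sum_add_distrib, ← smul_add]
  refine and_congr (forall_congr' fun j => ?_) (forall_congr' fun i => forall_congr' fun j =>
    imp_congr_right fun _ => ?_)
  · rw [_root_.mul_inv_rev, mul_smul, ← inv_smul_eq_iff₀ (inv_ne_zero hV), inv_inv]
  · rw [smul_eq_zero_iff_right hV]

theorem solvesKernelSystem_iff (hA : ConditionA a) (hD : IsUnit (detMain a))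
    (b : Matrix (Fin (q + r)) (Fin q) A) :
    SolvesKernelSystem a b ↔
      ∃ c : Matrix (Fin q) (Fin q) A, IsAdmissible (q + r) c ∧ b = cramerCoeff a c := by
  have hV := (ballVol_pos (q + r)).ne'
  constructor
  · intro h
    rw [solvesKernelSystem_iff_isAdmissible] at h
    set C := ballVol (q + r) • (a * bᵀ) with hC
    -- the given solution determines `c` as the leading block of `C`
    have htop : ∀ i, (fun l => C (Fin.castAdd r l) i) = ballVol (q + r) • (mainBlock a *ᵥ b i) := by
      intro i; rfl
    have hlow : ∀ k i, C (Fin.natAdd q k) i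
        = (transferMatrix a *ᵥ fun l => C (Fin.castAdd r l) i) k := by
      intro k i
      rw [htop, mulVec_smul, mulVec_mulVec, transferMatrix_mul_mainBlock hD]
      rfl
    let c : Matrix (Fin q) (Fin q) A := C.submatrix (Fin.castAdd r) (Fin.castAdd r)
    have hcol : ∀ i, topColumn a c i = fun l => C (Fin.castAdd r l) i := by
      intro i
      ext l
      refine Fin.addCases (fun i => ?_) (fun k => ?_) i
      · rw [topColumn_castAdd]; rfl
      · rw [topColumn_natAdd, neg_eq_iff_add_eq_zero]
        have h2 := h.2 (Fin.castAdd r l) (Fin.natAdd q k) (by simp [Fin.ext_iff]; omega)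
        rw [hlow] at h2
        exact h2
    refine ⟨c, ⟨fun i => h.1 _, fun i j hij => h.2 _ _ (by simpa using hij)⟩, ?_⟩
    funext i
    rw [cramerCoeff_eq, hcol, htop, mulVec_smul, smul_smul, inv_mul_cancel₀ hV, one_smul,
      mulVec_mulVec, nonsing_inv_mul _ hD, one_mulVec]
  · rintro ⟨c, hc, rfl⟩
    rw [solvesKernelSystem_iff_isAdmissible]
    have : ballVol (q + r) • (a * (cramerCoeff a c)ᵀ) = extendedCoeff a c := by
      ext j i
      rw [Matrix.smul_apply, mul_apply]
      simp only [transpose_apply]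
      rw [sum_mul_cramerCoeff hD, smul_smul, mul_inv_cancel₀ hV, one_smul]
    rw [this]
    exact hc.extendedCoeff hA hD

end KernelSystem

/-! ### Oblique coordinates -/

section Oblique

variable {E : Type*} [NormedAddCommGroup E] [InnerProductSpace ℝ E]

/-- The coordinates `(t, y) ↦ t (ν + w) + y` on `E`, for `y, w` orthogonal to `ν`. -/
noncomputable def slant (ν : E) (w : (ℝ ∙ ν)ᗮ) : ℝ × (ℝ ∙ ν)ᗮ →L[ℝ] E :=
  ((ContinuousLinearMap.id ℝ ℝ).smulRight (ν + w)).coprod (ℝ ∙ ν)ᗮ.subtypeL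

/-- The projection of `E` onto the hyperplane orthogonal to `ν`, along `ν + w`. -/
noncomputable def obliqueProj (ν : E) (w : (ℝ ∙ ν)ᗮ) : E →L[ℝ] (ℝ ∙ ν)ᗮ :=
  (ℝ ∙ ν)ᗮ.orthogonalProjectionOnto - (innerSL ℝ ν).smulRight w

variable {ν : E} {w : (ℝ ∙ ν)ᗮ}

theorem slant_apply (q : ℝ × (ℝ ∙ ν)ᗮ) : slant ν w q = q.1 • (ν + w) + q.2 := by
  simp [slant]

theorem inner_orthogonal (y : (ℝ ∙ ν)ᗮ) : inner ℝ ν (y : E) = 0 :=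
  Submodule.mem_orthogonal_singleton_iff_inner_right.1 y.2

theorem inner_slant (hν : ‖ν‖ = 1) (q : ℝ × (ℝ ∙ ν)ᗮ) : inner ℝ ν (slant ν w q) = q.1 := by
  rw [slant_apply, inner_add_right, inner_smul_right, inner_add_right, inner_orthogonal,
    inner_orthogonal, real_inner_self_eq_norm_sq, hν]
  simp

theorem coe_obliqueProj (hν : ‖ν‖ = 1) (z : E) :
    (obliqueProj ν w z : E) = z - inner ℝ ν z • (ν + w) := by
  simp only [obliqueProj, _root_.sub_apply, Submodule.coe_sub,
    ContinuousLinearMap.smulRight_apply, innerSL_apply_apply, Submodule.coe_smul]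
  rw [← Submodule.starProjection_apply, Submodule.starProjection_orthogonal_val,
    Submodule.starProjection_unit_singleton ℝ hν, smul_add]
  abel

theorem obliqueProj_slant (hν : ‖ν‖ = 1) (q : ℝ × (ℝ ∙ ν)ᗮ) :
    obliqueProj ν w (slant ν w q) = q.2 := by
  ext
  rw [coe_obliqueProj hν, inner_slant hν, slant_apply]
  abel

theorem slant_obliqueProj (hν : ‖ν‖ = 1) (z : E) :
    slant ν w (inner ℝ ν z, obliqueProj ν w z) = z := by
  rw [slant_apply, coe_obliqueProj hν]
  abel

variable [FiniteDimensional ℝ E] [MeasurableSpace E] [BorelSpace E]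

/-- A shear of orthogonal coordinates preserves the volume. -/
theorem measurePreserving_slant (hν : ‖ν‖ = 1) :
    MeasurePreserving (slant ν w) (volume : Measure (ℝ × (ℝ ∙ ν)ᗮ)) (volume : Measure E) := by
  have h1 : MeasurePreserving (fun q : ℝ × (ℝ ∙ ν)ᗮ => (q.1, q.1 • w + q.2))
      (volume : Measure (ℝ × (ℝ ∙ ν)ᗮ)) volume := by
    refine (MeasurePreserving.id (volume : Measure ℝ)).skew_product
      (g := fun (t : ℝ) (y : (ℝ ∙ ν)ᗮ) => t • w + y) (by fun_prop) ?_
    exact Filter.Eventually.of_forall fun t => (measurePreserving_add_left volume (t • w)).map_eq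
  have h2 : MeasurePreserving (Prod.map (LinearIsometryEquiv.toSpanUnitSingleton (𝕜 := ℝ) ν hν) id)
      (volume : Measure (ℝ × (ℝ ∙ ν)ᗮ)) volume :=
    (LinearIsometryEquiv.measurePreserving _).prod (MeasurePreserving.id volume)
  have h3 := ((ℝ ∙ ν).measurePreserving_measurableEquivProd (0 : E)).symm
  rw [InnerProductSpace.euclideanHausdorffMeasure_eq_volume] at h3
  have h4 : ⇑(slant ν w) = (((ℝ ∙ ν).measurableEquivProd (0 : E)).symm ∘
      Prod.map (LinearIsometryEquiv.toSpanUnitSingleton (𝕜 := ℝ) ν hν) id ∘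
      fun q : ℝ × (ℝ ∙ ν)ᗮ => (q.1, q.1 • w + q.2)) := by
    funext q
    simp [slant_apply, smul_add, add_assoc]
  rw [h4]
  exact h3.comp (h2.comp h1)

theorem measurableEmbedding_slant (hν : ‖ν‖ = 1) : MeasurableEmbedding (slant ν w) :=
  (ContinuousLinearEquiv.equivOfInverse (slant ν w) ((innerSL ℝ ν).prod (obliqueProj ν w))
    (fun q => by ext1 <;> simp [inner_slant hν, obliqueProj_slant hν])
    (fun z => by simp [slant_obliqueProj hν])).toHomeomorph.measurableEmbedding

end Oblique

/-! ### Functions of class `C¹` up to the boundary -/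

section ClosureDomain

variable {E F : Type*} [NormedAddCommGroup E] [NormedSpace ℝ E]
  [NormedAddCommGroup F] [NormedSpace ℝ F] {D : Set E} {u : E → F}

theorem differentiableAt_of_contDiffOn_closure (hD : IsOpen D) (hu : ContDiffOn ℝ 1 u (closure D))
    {z : E} (hz : z ∈ D) : DifferentiableAt ℝ u z :=
  ((hu.mono subset_closure).contDiffAt (hD.mem_nhds hz)).differentiableAt one_ne_zero

/-- Near each point of the closure the derivative in `D` agrees with a continuous function, so it
is bounded on `D` by compactness. -/
theorem exists_norm_fderiv_le [ProperSpace E] (hD : IsOpen D) (hb : Bornology.IsBounded D)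
    (hu : ContDiffOn ℝ 1 u (closure D)) : ∃ C, ∀ z ∈ D, ‖fderiv ℝ u z‖ ≤ C := by
  have hc : IsCompact (closure D) := hb.isCompact_closure
  suffices ∃ C, ∀ z ∈ closure D ∩ D, ‖fderiv ℝ u z‖ ≤ C by
    obtain ⟨C, hC⟩ := this
    exact ⟨C, fun z hz => hC z ⟨subset_closure hz, hz⟩⟩
  refine hc.induction_on (p := fun s => ∃ C, ∀ z ∈ s ∩ D, ‖fderiv ℝ u z‖ ≤ C) ?_ ?_ ?_ ?_
  · exact ⟨0, by simp⟩
  · rintro s t hst ⟨C, hC⟩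
    exact ⟨C, fun z hz => hC z ⟨hst hz.1, hz.2⟩⟩
  · rintro s t ⟨C, hC⟩ ⟨C', hC'⟩
    refine ⟨max C C', ?_⟩
    rintro z ⟨hz | hz, hzD⟩
    · exact (hC z ⟨hz, hzD⟩).trans (le_max_left _ _)
    · exact (hC' z ⟨hz, hzD⟩).trans (le_max_right _ _)
  · intro p hp
    obtain ⟨V, hV, -, f', hf', hf'c⟩ :=
      (contDiffWithinAt_succ_iff_hasFDerivWithinAt (n := 0) (by simp)).1
        (by simpa using hu p hp)
    rw [Set.insert_eq_of_mem hp] at hV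
    have hcont : ContinuousWithinAt f' V p := hf'c.continuousWithinAt
    have hpV : p ∈ V := mem_of_mem_nhdsWithin hp hV
    have hev : ∀ᶠ z in nhdsWithin p V, ‖f' z‖ < ‖f' p‖ + 1 :=
      hcont.norm.eventually_lt_const (by linarith)
    obtain ⟨O, hO, hpO, hOV⟩ := mem_nhdsWithin.1 hV
    obtain ⟨O', hO', hpO', hOV'⟩ := mem_nhdsWithin.1 hev
    refine ⟨(O ∩ O') ∩ closure D, ?_, ‖f' p‖ + 1, ?_⟩
    · rw [Set.inter_comm]
      exact inter_mem_nhdsWithin _ ((hO.inter hO').mem_nhds ⟨hpO, hpO'⟩)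
    · rintro z ⟨⟨⟨hzO, hzO'⟩, -⟩, hzD⟩
      have hVz : V ∈ nhds z := Filter.mem_of_superset ((hO.inter hD).mem_nhds ⟨hzO, hzD⟩)
        fun y hy => hOV ⟨hy.1, subset_closure hy.2⟩
      have hzV : z ∈ V := mem_of_mem_nhds hVz
      rw [((hf' z hzV).hasFDerivAt hVz).fderiv]
      exact (hOV' ⟨hzO', hzV⟩ : ‖f' z‖ < _).le

theorem continuousOn_fderiv_of_contDiffOn_closure (hD : IsOpen D)
    (hu : ContDiffOn ℝ 1 u (closure D)) : ContinuousOn (fderiv ℝ u) D :=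
  (hu.mono subset_closure).continuousOn_fderiv_of_isOpen hD le_rfl

theorem integrableOn_fderiv_apply [MeasurableSpace E] [BorelSpace E] [ProperSpace E]
    [SecondCountableTopologyEither E F] {μ : Measure E} [IsFiniteMeasureOnCompacts μ]
    (hD : IsOpen D)
    (hb : Bornology.IsBounded D) (hu : ContDiffOn ℝ 1 u (closure D)) (v : E) :
    IntegrableOn (fun z => fderiv ℝ u z v) D μ := by
  obtain ⟨C, hC⟩ := exists_norm_fderiv_le hD hb hu
  have hcont : ContinuousOn (fun z => fderiv ℝ u z v) D :=
    (continuousOn_fderiv_of_contDiffOn_closure hD hu).clm_apply continuousOn_const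
  refine IntegrableOn.of_bound hb.measure_lt_top
    (hcont.aestronglyMeasurable hD.measurableSet) (C * ‖v‖) ?_
  refine (ae_restrict_iff' hD.measurableSet).2 (Filter.Eventually.of_forall fun z hz => ?_)
  exact ((fderiv ℝ u z).le_opNorm v).trans (mul_le_mul_of_nonneg_right (hC z hz) (norm_nonneg v))

end ClosureDomain

/-! ### Integration along transversal lines in a boundary box -/

section GraphBox

variable {E : Type*} [NormedAddCommGroup E] [InnerProductSpace ℝ E]

/-- The oblique box around `p` of height `2 h` over the ball of radius `r` of the hyperplane
orthogonal to `ν`. -/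
def graphBox (p ν : E) (w : (ℝ ∙ ν)ᗮ) (r h : ℝ) : Set E :=
  {z | |inner ℝ ν (z - p)| < h ∧ ‖obliqueProj ν w (z - p)‖ < r}

/-- In the box `graphBox p ν w r h` the set `D` is the region strictly below the graph of `g`, in
the coordinates given by `slant`, and the boundary of `D` is the graph. -/
structure IsGraphBox (D : Set E) (p ν : E) (w : (ℝ ∙ ν)ᗮ) (r h : ℝ) (g : (ℝ ∙ ν)ᗮ → ℝ) :
    Prop where
  abs_height_lt : ∀ y, ‖y‖ < r → |g y| < h
  mem_iff : ∀ y t, ‖y‖ < r → |t| < h → (p + slant ν w (t, y) ∈ D ↔ t < g y)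
  mem_frontier_iff : ∀ y t, ‖y‖ < r → |t| < h → (p + slant ν w (t, y) ∈ frontier D ↔ t = g y)

variable {D : Set E} {p ν : E} {w : (ℝ ∙ ν)ᗮ} {r h : ℝ} {g : (ℝ ∙ ν)ᗮ → ℝ}

theorem add_slant_mem_graphBox (hν : ‖ν‖ = 1) {q : ℝ × (ℝ ∙ ν)ᗮ} :
    p + slant ν w q ∈ graphBox p ν w r h ↔ |q.1| < h ∧ ‖q.2‖ < r := by
  simp only [graphBox, Set.mem_ofPred_eq, add_sub_cancel_left, inner_slant hν, obliqueProj_slant hν]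

theorem isOpen_graphBox : IsOpen (graphBox p ν w r h) := by
  have h1 : Continuous fun z : E => |inner ℝ ν (z - p)| := by fun_prop
  have h2 : Continuous fun z : E => ‖obliqueProj ν w (z - p)‖ := by fun_prop
  exact (isOpen_lt h1 continuous_const).inter (isOpen_lt h2 continuous_const)

theorem self_mem_graphBox (hr : 0 < r) (hh : 0 < h) : p ∈ graphBox p ν w r h := by
  simp [graphBox, hr, hh]

theorem IsGraphBox.mem_closure (hG : IsGraphBox D p ν w r h g) {y : (ℝ ∙ ν)ᗮ} (hy : ‖y‖ < r)
    {t : ℝ} (ht : t ∈ Set.Icc (-h) (g y)) : p + slant ν w (t, y) ∈ closure D := by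
  have hlt := abs_lt.1 (hG.abs_height_lt y hy)
  rw [← closure_Ioo hlt.1.ne] at ht
  have hc : Continuous fun t : ℝ => p + slant ν w (t, y) := by fun_prop
  refine closure_mono ?_ (image_closure_subset_closure_image hc ⟨t, ht, rfl⟩)
  rintro _ ⟨s, hs, rfl⟩
  exact (hG.mem_iff y s hy (abs_lt.2 ⟨hs.1, hs.2.trans hlt.2⟩)).2 hs.2

variable [FiniteDimensional ℝ E] [MeasurableSpace E] [BorelSpace E]
  {F : Type*} [NormedAddCommGroup F] [NormedSpace ℝ F] [CompleteSpace F] {u : E → F}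

/-- Fubini's theorem and the fundamental theorem of calculus along the lines of direction
`ν + w`. -/
theorem IsGraphBox.integral_fderiv_eq (hG : IsGraphBox D p ν w r h g) (hν : ‖ν‖ = 1)
    (hD : IsOpen D) (hb : Bornology.IsBounded D) (hu : ContDiffOn ℝ 1 u (closure D))
    (hsupp : tsupport u ⊆ graphBox p ν w r h) :
    ∫ z in D, fderiv ℝ u z (ν + w)
      = ∫ y in Metric.ball (0 : (ℝ ∙ ν)ᗮ) r, u (p + slant ν w (g y, y)) := by
  set f : E → F := D.indicator fun z => fderiv ℝ u z (ν + w) with hf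
  have hfi : Integrable f := (integrable_indicator_iff hD.measurableSet).2
    (integrableOn_fderiv_apply hD hb hu _)
  have hmp := measurePreserving_slant (w := w) hν
  have hme := measurableEmbedding_slant (w := w) hν
  have hfi' : Integrable (fun q => f (p + slant ν w q)) :=
    (hmp.integrable_comp_emb hme (g := fun z => f (p + z))).2 (hfi.comp_add_left p)
  have hf0 : ∀ z, z ∉ graphBox p ν w r h → f z = 0 := by
    intro z hz
    by_cases hzD : z ∈ D
    · rw [hf, Set.indicator_of_mem hzD, fderiv_of_notMem_tsupport ℝ (fun hzs => hz (hsupp hzs))]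
      rfl
    · exact Set.indicator_of_notMem hzD _
  obtain ⟨C, hC⟩ := exists_norm_fderiv_le hD hb hu
  have hline : ∀ y : (ℝ ∙ ν)ᗮ, ∫ t : ℝ, f (p + slant ν w (t, y))
      = (Metric.ball (0 : (ℝ ∙ ν)ᗮ) r).indicator (fun y => u (p + slant ν w (g y, y))) y := by
    intro y
    by_cases hy : ‖y‖ < r
    swap
    · rw [Set.indicator_of_notMem (by simpa using hy)]
      refine integral_eq_zero_of_ae (Filter.Eventually.of_forall fun t => ?_)
      exact hf0 _ fun hz => hy ((add_slant_mem_graphBox hν).1 hz).2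
    rw [Set.indicator_of_mem (by simpa using hy)]
    have hlt := abs_lt.1 (hG.abs_height_lt y hy)
    have hmemD : ∀ t ∈ Set.Ioo (-h) (g y), p + slant ν w (t, y) ∈ D := fun t ht =>
      (hG.mem_iff y t hy (abs_lt.2 ⟨ht.1, ht.2.trans hlt.2⟩)).2 ht.2
    have h1 : (fun t : ℝ => f (p + slant ν w (t, y)))
        = (Set.Ioo (-h) (g y)).indicator
          fun t => fderiv ℝ u (p + slant ν w (t, y)) (ν + w) := by
      funext t
      by_cases ht : t ∈ Set.Ioo (-h) (g y)
      · rw [Set.indicator_of_mem ht, hf, Set.indicator_of_mem (hmemD t ht)]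
      · rw [Set.indicator_of_notMem ht]
        by_cases hth : |t| < h
        · refine Set.indicator_of_notMem (fun hz => ht ⟨(abs_lt.1 hth).1, ?_⟩) _
          exact (hG.mem_iff y t hy hth).1 hz
        · exact hf0 _ fun hz => hth ((add_slant_mem_graphBox hν).1 hz).1
    have hc : Continuous fun t : ℝ => p + slant ν w (t, y) := by fun_prop
    have hderiv : ∀ t ∈ Set.Ioo (-h) (g y), HasDerivAt (fun t : ℝ => u (p + slant ν w (t, y)))
        (fderiv ℝ u (p + slant ν w (t, y)) (ν + w)) t := by
      intro t ht
      have hu' := (differentiableAt_of_contDiffOn_closure hD hu (hmemD t ht)).hasFDerivAt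
      refine hu'.comp_hasDerivAt t ?_
      have := (((hasDerivAt_id t).smul_const (ν + (w : E))).add_const (y : E)).const_add p
      simpa [slant_apply] using this
    have hint : IntegrableOn (fun t : ℝ => fderiv ℝ u (p + slant ν w (t, y)) (ν + w))
        (Set.Ioo (-h) (g y)) := by
      have hcont : ContinuousOn (fun t : ℝ => fderiv ℝ u (p + slant ν w (t, y)) (ν + w))
          (Set.Ioo (-h) (g y)) :=
        ((continuousOn_fderiv_of_contDiffOn_closure hD hu).comp hc.continuousOn hmemD).clm_apply
          continuousOn_const
      refine IntegrableOn.of_bound measure_Ioo_lt_top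
        (hcont.aestronglyMeasurable measurableSet_Ioo) (C * ‖ν + w‖) ?_
      refine (ae_restrict_iff' measurableSet_Ioo).2 (Filter.Eventually.of_forall fun t ht => ?_)
      exact ((fderiv ℝ u _).le_opNorm _).trans
        (mul_le_mul_of_nonneg_right (hC _ (hmemD t ht)) (norm_nonneg _))
    have hbot : u (p + slant ν w (-h, y)) = 0 := by
      refine image_eq_zero_of_notMem_tsupport fun hz => ?_
      have := ((add_slant_mem_graphBox hν).1 (hsupp hz)).1
      rw [abs_neg] at this
      exact (lt_irrefl _) ((le_abs_self h).trans_lt this)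
    rw [h1, integral_indicator measurableSet_Ioo, ← integral_Ioc_eq_integral_Ioo,
      ← intervalIntegral.integral_of_le hlt.1.le,
      intervalIntegral.integral_eq_sub_of_hasDerivAt_of_le hlt.1.le
        (hu.continuousOn.comp hc.continuousOn fun t ht => hG.mem_closure hy ht) hderiv
        ((intervalIntegrable_iff_integrableOn_Ioo_of_le hlt.1.le).2 hint)]
    simp only [Function.comp_apply, hbot, sub_zero]
  calc ∫ z in D, fderiv ℝ u z (ν + w) = ∫ z, f z := (integral_indicator hD.measurableSet).symm
    _ = ∫ z, f (p + z) := (integral_add_left_eq_self f p).symm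
    _ = ∫ q, f (p + slant ν w q) := (hmp.integral_comp hme fun z => f (p + z)).symm
    _ = ∫ y, ∫ t, f (p + slant ν w (t, y)) := integral_prod_symm _ hfi'
    _ = _ := by
      simp_rw [hline]
      exact integral_indicator Metric.isOpen_ball.measurableSet

end GraphBox

/-! ### Existence of boundary boxes -/

section ExistsGraphBox

variable {E : Type*} [NormedAddCommGroup E] [InnerProductSpace ℝ E]

/-- If `ρ` is close to a linear function with gradient `c ν` in the sense of strict
differentiability, then small boxes around a zero of `ρ` are boundary boxes of the set
`{ρ < 0}`. -/
theorem exists_isGraphBox_of_approx {D : Set E} (hD : IsOpen D) {p ν : E} (hν : ‖ν‖ = 1)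
    (w : (ℝ ∙ ν)ᗮ) {ρ : E → ℝ} {c δ R : ℝ} (hc : 0 < c) (hR : 0 < R)
    (hδ : δ * ‖ν + w‖ ≤ 1 / 2) (hδ' : δ ≤ 1 / 2)
    (hρ : ContinuousOn ρ (Metric.ball p R)) (hρp : ρ p = 0)
    (hmem : ∀ z ∈ Metric.ball p R, z ∈ D ↔ ρ z < 0)
    (happ : ∀ y ∈ Metric.ball p R, ∀ z ∈ Metric.ball p R,
      |ρ y - ρ z - c * inner ℝ ν (y - z)| ≤ c * δ * ‖y - z‖) :
    ∃ r h g, 0 < r ∧ 0 < h ∧ IsGraphBox D p ν w r h g ∧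
      graphBox p ν w r h ⊆ Metric.ball p R ∧
      ∀ y ∈ frontier D ∩ graphBox p ν w r h, ∀ z ∈ frontier D ∩ graphBox p ν w r h,
        |inner ℝ ν (y - z)| ≤ δ * ‖y - z‖ := by
  set S := ‖ν + w‖ with hS
  have hS1 : 1 ≤ S := by
    have h1 : inner ℝ ν (ν + (w : E)) = 1 := by
      rw [inner_add_right, inner_orthogonal, real_inner_self_eq_norm_sq, hν]; norm_num
    have h2 := real_inner_le_norm ν (ν + (w : E))
    rw [h1, hν, one_mul] at h2
    exact h2
  have hS0 : 0 < S := by linarith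
  have hball := Metric.isOpen_ball (x := p) (ε := R)
  -- inside the ball the boundary is the zero set of `ρ`
  have hfr : ∀ z ∈ Metric.ball p R, z ∈ frontier D ↔ ρ z = 0 := by
    intro z hz
    have hca : ContinuousAt ρ z := hρ.continuousAt (hball.mem_nhds hz)
    rw [hD.frontier_eq]
    constructor
    · rintro ⟨hzc, hzD⟩
      rw [hmem z hz, not_lt] at hzD
      refine le_antisymm ?_ hzD
      by_contra! hpos
      obtain ⟨y, ⟨hy, hyB⟩, hyD⟩ := mem_closure_iff_nhds.1 hzc _
        ((hca.eventually_const_lt hpos).and (hball.mem_nhds hz))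
      exact absurd ((hmem y hyB).1 hyD) (not_lt.2 (le_of_lt hy))
    · intro h0
      refine ⟨?_, fun hzD => ((hmem z hz).1 hzD).ne h0⟩
      have hl : Filter.Tendsto (fun t : ℝ => z - t • ν) (nhdsWithin 0 (Set.Ioi 0)) (nhds z) := by
        have : Continuous fun t : ℝ => z - t • ν := by fun_prop
        simpa using (this.tendsto 0).mono_left nhdsWithin_le_nhds
      refine mem_closure_of_tendsto hl ?_
      filter_upwards [hl.eventually (hball.mem_nhds hz), self_mem_nhdsWithin] with t htB ht
      have ht0 : (0 : ℝ) < t := ht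
      have h1 := (abs_le.1 (happ _ htB _ hz)).2
      rw [sub_sub_cancel_left, inner_neg_right, inner_smul_right, real_inner_self_eq_norm_sq, hν,
        norm_neg, norm_smul, hν, Real.norm_of_nonneg ht0.le, h0] at h1
      refine (hmem _ htB).2 ?_
      have : 0 < c * t := by positivity
      nlinarith
  -- the box fits into the ball, and is high enough for `ρ` to change sign on each vertical line
  set h := R / (4 * S) with hh
  set r := R / (16 * S) with hr
  have hh0 : 0 < h := by positivity
  have hr0 : 0 < r := by positivity
  have hrh : h = 4 * r := by rw [hh, hr]; field_simp; norm_num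
  have hhS : h * S = R / 4 := by rw [hh]; field_simp
  have hrR : r ≤ R / 16 := by
    rw [hr]; gcongr; linarith
  have hin : ∀ (t : ℝ) (y : (ℝ ∙ ν)ᗮ), |t| < h → ‖y‖ < r →
      p + slant ν w (t, y) ∈ Metric.ball p R := by
    intro t y ht hy
    rw [Metric.mem_ball, dist_eq_norm, add_sub_cancel_left, slant_apply]
    have h1 : ‖t • (ν + (w : E))‖ ≤ h * S := by
      rw [norm_smul, Real.norm_eq_abs]; gcongr
    have h2 : ‖(y : E)‖ < r := hy
    refine (norm_add_le _ _).trans_lt ?_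
    linarith
  have hsub : graphBox p ν w r h ⊆ Metric.ball p R := by
    intro z hz
    have := hin _ _ hz.1 hz.2
    rwa [slant_obliqueProj hν, add_sub_cancel] at this
  -- `ρ` increases along the lines of direction `ν + w`
  have hmono : ∀ (y : (ℝ ∙ ν)ᗮ), ‖y‖ < r → ∀ s t : ℝ, |s| < h → |t| < h → s < t →
      ρ (p + slant ν w (s, y)) < ρ (p + slant ν w (t, y)) := by
    intro y hy s t hs ht hst
    have hd : p + slant ν w (t, y) - (p + slant ν w (s, y)) = (t - s) • (ν + (w : E)) := by
      rw [slant_apply, slant_apply, sub_smul]; abel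
    have h1 := (abs_le.1 (happ _ (hin t y ht hy) _ (hin s y hs hy))).1
    rw [hd, inner_smul_right, inner_add_right, inner_orthogonal, real_inner_self_eq_norm_sq, hν,
      norm_smul, ← hS, Real.norm_of_nonneg (by linarith)] at h1
    have : 0 < c * (t - s) := mul_pos hc (by linarith)
    nlinarith
  have hval : ∀ (y : (ℝ ∙ ν)ᗮ), ‖y‖ < r → ∀ t : ℝ, |t| < h →
      |ρ (p + slant ν w (t, y)) - c * t| ≤ c * (|t| / 2 + r / 2) := by
    intro y hy t ht
    have h1 := happ _ (hin t y ht hy) p (Metric.mem_ball_self hR)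
    rw [add_sub_cancel_left, inner_slant hν, hρp, sub_zero] at h1
    refine h1.trans ?_
    rw [mul_assoc]
    refine mul_le_mul_of_nonneg_left ?_ hc.le
    by_cases hδ0 : 0 ≤ δ
    · have h2 : ‖slant ν w (t, y)‖ ≤ |t| * S + ‖y‖ := by
        rw [slant_apply]
        refine (norm_add_le _ _).trans_eq ?_
        rw [norm_smul, Real.norm_eq_abs]; rfl
      calc δ * ‖slant ν w (t, y)‖ ≤ δ * (|t| * S + ‖y‖) := by gcongr
        _ = |t| * (δ * S) + δ * ‖y‖ := by ring
        _ ≤ |t| * (1 / 2) + 1 / 2 * r := by gcongr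
        _ = _ := by ring
    · refine (mul_nonpos_of_nonpos_of_nonneg (not_le.1 hδ0).le (norm_nonneg _)).trans ?_
      positivity
  have hroot : ∀ y : (ℝ ∙ ν)ᗮ, ∃ t, ‖y‖ < r → |t| < h ∧ ρ (p + slant ν w (t, y)) = 0 := by
    intro y
    by_cases hy : ‖y‖ < r
    swap
    · exact ⟨0, fun hy' => absurd hy' hy⟩
    have hin' : ∀ t ∈ Set.Icc (-(h / 2)) (h / 2), |t| < h := fun t ht =>
      (abs_le.2 ht).trans_lt (by linarith)
    have hcont : ContinuousOn (fun t : ℝ => ρ (p + slant ν w (t, y)))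
        (Set.Icc (-(h / 2)) (h / 2)) :=
      hρ.comp (by fun_prop) fun t ht => hin t y (hin' t ht) hy
    have hhalf : |h / 2| < h := by rw [abs_of_pos (by linarith)]; linarith
    have hup := (abs_le.1 (hval y hy (h / 2) hhalf)).1
    have hlo := (abs_le.1 (hval y hy (-(h / 2)) (by rwa [abs_neg]))).2
    rw [abs_neg] at hlo
    rw [abs_of_pos (by linarith : 0 < h / 2)] at hup hlo
    have hcr : 0 < c * r := mul_pos hc hr0
    obtain ⟨t, ht, ht0⟩ := intermediate_value_Icc (by linarith : -(h / 2) ≤ h / 2) hcont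
      (show (0 : ℝ) ∈ Set.Icc _ _ from ⟨by rw [hrh] at hlo ⊢; nlinarith,
        by rw [hrh] at hup ⊢; nlinarith⟩)
    exact ⟨t, fun _ => ⟨hin' t ht, ht0⟩⟩
  choose g hg using hroot
  refine ⟨r, h, g, hr0, hh0, ⟨fun y hy => (hg y hy).1, fun y t hy ht => ?_, fun y t hy ht => ?_⟩,
    hsub, ?_⟩
  · rw [hmem _ (hin t y ht hy)]
    obtain ⟨hgy, hg0⟩ := hg y hy
    constructor
    · intro hlt
      by_contra! hle
      rcases hle.lt_or_eq with hlt' | heq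
      · have := hmono y hy _ _ hgy ht hlt'
        linarith
      · rw [← heq] at hlt; exact hlt.ne hg0
    · intro hlt
      have := hmono y hy _ _ ht hgy hlt
      linarith
  · rw [hfr _ (hin t y ht hy)]
    obtain ⟨hgy, hg0⟩ := hg y hy
    constructor
    · intro h0
      rcases lt_trichotomy t (g y) with hlt | heq | hlt
      · have := hmono y hy _ _ ht hgy hlt
        linarith
      · exact heq
      · have := hmono y hy _ _ hgy ht hlt
        linarith
    · rintro rfl
      exact hg0
  · rintro y ⟨hyf, hy⟩ z ⟨hzf, hz⟩
    have h1 := happ y (hsub hy) z (hsub hz)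
    rw [(hfr y (hsub hy)).1 hyf, (hfr z (hsub hz)).1 hzf, sub_zero, zero_sub, abs_neg, abs_mul,
      abs_of_pos hc, mul_assoc] at h1
    exact le_of_mul_le_mul_left h1 hc

end ExistsGraphBox

theorem IsDefiningFunction.eq_zero_of_mem_frontier {n : ℕ} {D U : Set (EuclideanSpace ℝ (Fin n))}
    {ρ : EuclideanSpace ℝ (Fin n) → ℝ} (h : IsDefiningFunction D U ρ)
    {p : EuclideanSpace ℝ (Fin n)} (hpU : p ∈ U) (hp : p ∈ frontier D) : ρ p = 0 := by
  have hU := h.isOpen.mem_nhds hpU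
  have hca : ContinuousAt ρ p := h.contDiffOn.continuousOn.continuousAt hU
  refine le_antisymm ?_ ?_
  · by_contra! hpos
    obtain ⟨y, ⟨hy, hyU⟩, hyD⟩ := mem_closure_iff_nhds.1 hp.1 _
      ((hca.eventually_const_lt hpos).and hU)
    exact absurd ((h.mem_iff y hyU).1 hyD) (not_lt.2 (le_of_lt hy))
  · by_contra! hneg
    refine hp.2 (mem_interior_iff_mem_nhds.2 ?_)
    filter_upwards [hca.eventually_lt_const hneg, hU] with y hy hyU
    exact (h.mem_iff y hyU).2 hy

theorem IsOutwardUnitNormal.norm_eq_one {n : ℕ} {D : Set (EuclideanSpace ℝ (Fin n))}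
    {p ν : EuclideanSpace ℝ (Fin n)} (hν : IsOutwardUnitNormal D p ν) : ‖ν‖ = 1 := by
  obtain ⟨U, ρ, hpU, h, rfl⟩ := hν
  rw [norm_smul, norm_inv, norm_norm,
    inv_mul_cancel₀ (norm_ne_zero_iff.2 (h.gradient_ne_zero p hpU))]

/-- Arbitrarily small boxes around a boundary point are boundary boxes, whatever the transversal
direction `ν + w`, and the boundary chords in them are nearly orthogonal to the normal `ν`. -/
theorem exists_isGraphBox {n : ℕ} {D : Set (EuclideanSpace ℝ (Fin n))} (hD : IsOpen D)
    {p ν : EuclideanSpace ℝ (Fin n)} (hp : p ∈ frontier D) (hν : IsOutwardUnitNormal D p ν)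
    (w : (ℝ ∙ ν)ᗮ) {η : ℝ} (hη : 0 < η) {O : Set (EuclideanSpace ℝ (Fin n))} (hO : O ∈ nhds p) :
    ∃ r h g, 0 < r ∧ 0 < h ∧ IsGraphBox D p ν w r h g ∧ graphBox p ν w r h ⊆ O ∧
      ∀ y ∈ frontier D ∩ graphBox p ν w r h, ∀ z ∈ frontier D ∩ graphBox p ν w r h,
        |inner ℝ ν (y - z)| ≤ η * ‖y - z‖ := by
  have hν1 := hν.norm_eq_one
  obtain ⟨U, ρ, hpU, h, hνρ⟩ := hν
  set c := ‖gradient ρ p‖ with hc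
  have hc0 : 0 < c := norm_pos_iff.2 (h.gradient_ne_zero p hpU)
  have hgrad : ∀ z, fderiv ℝ ρ p z = c * inner ℝ ν z := by
    intro z
    rw [hνρ, real_inner_smul_left, mul_inv_cancel_left₀ hc0.ne', gradient,
      InnerProductSpace.toDual_symm_apply]
  have hstrict : HasStrictFDerivAt ρ (fderiv ℝ ρ p) p :=
    (h.contDiffOn.contDiffAt (h.isOpen.mem_nhds hpU)).hasStrictFDerivAt (by simp)
  set S := ‖ν + w‖ with hS
  obtain ⟨δ, hδ0, hδη, hδS, hδ⟩ : ∃ δ, 0 < δ ∧ δ ≤ η ∧ δ * S ≤ 1 / 2 ∧ δ ≤ 1 / 2 := by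
    have hS0 : 0 ≤ S := norm_nonneg _
    have hS1 : S + 1 ≠ 0 := by positivity
    refine ⟨min η (1 / (2 * (S + 1))), by positivity, min_le_left _ _, ?_, ?_⟩
    · calc min η (1 / (2 * (S + 1))) * S ≤ 1 / (2 * (S + 1)) * (S + 1) := by
            gcongr
            · exact min_le_right _ _
            · exact le_add_of_nonneg_right zero_le_one
        _ = 1 / 2 := by field_simp
    · refine (min_le_right _ _).trans ?_
      gcongr
      linarith
  have hev := hstrict.isLittleO.def (mul_pos hc0 hδ0)
  have hUO : O ∩ U ∈ nhds p := Filter.inter_mem hO (h.isOpen.mem_nhds hpU)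
  obtain ⟨R, hR, hRO, hRapp⟩ : ∃ R > 0, Metric.ball p R ⊆ O ∩ U ∧ ∀ y ∈ Metric.ball p R,
      ∀ z ∈ Metric.ball p R,
        ‖ρ y - ρ z - fderiv ℝ ρ p (y - z)‖ ≤ c * δ * ‖y - z‖ := by
    rw [nhds_prod_eq] at hev
    obtain ⟨V, hV, hVV⟩ := Filter.mem_prod_same_iff.1 hev
    obtain ⟨R, hR, hRV⟩ := Metric.mem_nhds_iff.1 (Filter.inter_mem hUO hV)
    exact ⟨R, hR, fun z hz => (hRV hz).1, fun y hy z hz =>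
      @hVV (y, z) ⟨(hRV hy).2, (hRV hz).2⟩⟩
  obtain ⟨r, k, g, hr, hk, hG, hsub, hchord⟩ := exists_isGraphBox_of_approx hD hν1 w (ρ := ρ) hc0 hR
    hδS hδ (h.contDiffOn.continuousOn.mono fun z hz => (hRO hz).2)
    (h.eq_zero_of_mem_frontier hpU hp) (fun z hz => h.mem_iff z (hRO hz).2) (fun y hy z hz => by
      have := hRapp y hy z hz
      rwa [hgrad, Real.norm_eq_abs] at this)
  exact ⟨r, k, g, hr, hk, hG, fun z hz => (hRO (hsub hz)).1, fun y hy z hz =>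
    (hchord y hy z hz).trans (by gcongr)⟩

/-! ### Comparison of the surface measure with the measure of the tangent hyperplane -/

section Comparison

open scoped NNReal

/-- Integrals against two measures that agree up to a factor `c` differ little if `c` is close
to `1`. -/
theorem norm_integral_sub_integral_le {X F : Type*} [MeasurableSpace X] [NormedAddCommGroup F]
    [NormedSpace ℝ F] {μ ν : Measure X} [IsFiniteMeasure μ] [IsFiniteMeasure ν] {c : ℝ≥0}
    (hc : 1 ≤ c) (h1 : μ ≤ c • ν) (h2 : ν ≤ c • μ) {φ : X → F} (hφ : Integrable φ ν) :
    ‖∫ x, φ x ∂μ - ∫ x, φ x ∂ν‖ ≤ 3 * ((c : ℝ) - 1) * ∫ x, ‖φ x‖ ∂ν := by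
  have hc' : (1 : ℝ) ≤ c := by exact_mod_cast hc
  have hcν : Integrable φ (c • ν) := hφ.smul_measure_nnreal
  have hμ : Integrable φ μ := hcν.mono_measure h1
  -- the defect `c ν - μ` is a measure, of small total mass
  set d : Measure X := c • ν - μ with hd
  have hsum : d + μ = c • ν := Measure.sub_add_cancel_of_le h1
  have hdi : Integrable φ d := hcν.mono_measure (hsum ▸ Measure.le_add_right le_rfl)
  have e1 : ∫ x, φ x ∂d + ∫ x, φ x ∂μ = (c : ℝ) • ∫ x, φ x ∂ν := by
    rw [← integral_add_measure hdi hμ, hsum, integral_smul_nnreal_measure]; rfl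
  have e2 : ∫ x, ‖φ x‖ ∂d + ∫ x, ‖φ x‖ ∂μ = (c : ℝ) * ∫ x, ‖φ x‖ ∂ν := by
    rw [← integral_add_measure hdi.norm hμ.norm, hsum, integral_smul_nnreal_measure]; rfl
  have e3 : ∫ x, ‖φ x‖ ∂ν ≤ (c : ℝ) * ∫ x, ‖φ x‖ ∂μ := by
    have := integral_mono_measure h2 (Filter.Eventually.of_forall fun x => norm_nonneg (φ x))
      (hμ.norm.smul_measure_nnreal (c := c))
    rwa [integral_smul_nnreal_measure] at this
  have hN : 0 ≤ ∫ x, ‖φ x‖ ∂ν := integral_nonneg fun x => norm_nonneg _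
  have key : ∫ x, φ x ∂μ - ∫ x, φ x ∂ν = ((c : ℝ) - 1) • ∫ x, φ x ∂ν - ∫ x, φ x ∂d := by
    rw [sub_smul, one_smul, ← e1]; abel
  have b1 : ‖((c : ℝ) - 1) • ∫ x, φ x ∂ν‖ ≤ (c - 1) * ∫ x, ‖φ x‖ ∂ν := by
    rw [norm_smul, Real.norm_of_nonneg (by linarith)]
    refine mul_le_mul_of_nonneg_left ?_ (by linarith)
    exact norm_integral_le_integral_norm _
  have b2 : ‖∫ x, φ x ∂d‖ ≤ 2 * (c - 1) * ∫ x, ‖φ x‖ ∂ν := by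
    refine (norm_integral_le_integral_norm _).trans ?_
    set N := ∫ x, ‖φ x‖ ∂ν
    set M := ∫ x, ‖φ x‖ ∂μ
    have : N / c ≤ M := by rw [div_le_iff₀ (by linarith)]; linarith
    have h3 : (c : ℝ) * N - N / c ≤ 2 * (c - 1) * N := by
      have : (c : ℝ) - 1 / c ≤ 2 * (c - 1) := by
        rw [sub_le_iff_le_add, ← sub_le_iff_le_add', le_div_iff₀ (by linarith)]
        nlinarith
      calc (c : ℝ) * N - N / c = (c - 1 / c) * N := by ring
        _ ≤ _ := by gcongr
    linarith
  rw [key]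
  refine (norm_sub_le _ _).trans ((add_le_add b1 b2).trans_eq ?_)
  ring

theorem euclideanHausdorffMeasure_image_le {X Y : Type*} [EMetricSpace X] [MeasurableSpace X]
    [BorelSpace X] [EMetricSpace Y] [MeasurableSpace Y] [BorelSpace Y] {K : ℝ≥0} {f : X → Y}
    {s : Set X} (hf : LipschitzOnWith K f s) (d : ℕ) :
    μHE[d] (f '' s) ≤ (K ^ d : ℝ≥0) • μHE[d] s := by
  have := hf.hausdorffMeasure_image_le (d := d) (Nat.cast_nonneg d)
  rw [Measure.euclideanHausdorffMeasure_def, Measure.euclideanHausdorffMeasure_def,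
    Measure.smul_apply, Measure.smul_apply, smul_comm]
  refine smul_le_smul_of_nonneg_left (this.trans_eq ?_) zero_le
  rw [ENNReal.rpow_natCast, ENNReal.smul_def, smul_eq_mul, ENNReal.coe_pow]

variable {E : Type*} [NormedAddCommGroup E] [InnerProductSpace ℝ E] {D : Set E} {p ν : E}
  {w : (ℝ ∙ ν)ᗮ} {r h : ℝ} {g : (ℝ ∙ ν)ᗮ → ℝ}

theorem IsGraphBox.mem_frontier_inter (hG : IsGraphBox D p ν w r h g) (hν : ‖ν‖ = 1)
    {y : (ℝ ∙ ν)ᗮ} (hy : ‖y‖ < r) :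
    p + slant ν w (g y, y) ∈ frontier D ∩ graphBox p ν w r h :=
  ⟨(hG.mem_frontier_iff y _ hy (hG.abs_height_lt y hy)).2 rfl,
    (add_slant_mem_graphBox hν).2 ⟨hG.abs_height_lt y hy, hy⟩⟩

theorem IsGraphBox.eq_add_slant (hG : IsGraphBox D p ν w r h g) (hν : ‖ν‖ = 1) {z : E}
    (hz : z ∈ frontier D ∩ graphBox p ν w r h) :
    p + slant ν w (g (obliqueProj ν w (z - p)), obliqueProj ν w (z - p)) = z := by
  have hzz : p + slant ν w (inner ℝ ν (z - p), obliqueProj ν w (z - p)) = z := by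
    rw [slant_obliqueProj hν, add_sub_cancel]
  have := (hG.mem_frontier_iff (obliqueProj ν w (z - p)) (inner ℝ ν (z - p)) hz.2.2 hz.2.1).1
    (by rw [hzz]; exact hz.1)
  rw [← this, hzz]

/-- Chords of the boundary that are nearly orthogonal to `ν` are nearly preserved by the oblique
projection. -/
theorem norm_obliqueProj_bounds (hν : ‖ν‖ = 1) {K η : ℝ} (hK : 1 ≤ K)
    (hη : η * ‖ν + w‖ ≤ 1 - K⁻¹) {d : E} (hd : |inner ℝ ν d| ≤ η * ‖d‖) :
    ‖obliqueProj ν w d‖ ≤ K * ‖d‖ ∧ ‖d‖ ≤ K * ‖obliqueProj ν w d‖ := by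
  have hK0 : 0 < K := by linarith
  have h1 : ‖inner ℝ ν d • (ν + (w : E))‖ ≤ (1 - K⁻¹) * ‖d‖ := by
    rw [norm_smul, Real.norm_eq_abs]
    calc |inner ℝ ν d| * ‖ν + (w : E)‖ ≤ η * ‖d‖ * ‖ν + (w : E)‖ := by gcongr
      _ = η * ‖ν + (w : E)‖ * ‖d‖ := by ring
      _ ≤ _ := by gcongr
  have h2 : ‖obliqueProj ν w d‖ = ‖d - inner ℝ ν d • (ν + (w : E))‖ := by
    rw [← coe_obliqueProj hν]; rfl
  have hd0 := norm_nonneg d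
  constructor
  · have h3 : (1 + (1 - K⁻¹)) * ‖d‖ ≤ K * ‖d‖ := by
      gcongr
      have : K + K⁻¹ - 2 = (K - 1) ^ 2 / K := by field_simp; ring
      have : 0 ≤ (K - 1) ^ 2 / K := by positivity
      linarith
    rw [h2]
    refine (norm_sub_le _ _).trans ?_
    linarith
  · have h3 : ‖d‖ ≤ ‖d - inner ℝ ν d • (ν + (w : E))‖ + ‖inner ℝ ν d • (ν + (w : E))‖ := by
      simpa using norm_add_le (d - inner ℝ ν d • (ν + (w : E))) (inner ℝ ν d • (ν + (w : E)))
    rw [h2]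
    have h4 : K⁻¹ * ‖d‖ ≤ ‖d - inner ℝ ν d • (ν + (w : E))‖ := by linarith
    rwa [inv_mul_le_iff₀ hK0] at h4

variable [FiniteDimensional ℝ E]

theorem finrank_orthogonal_eq (hν : ‖ν‖ = 1) :
    Module.finrank ℝ (ℝ ∙ ν)ᗮ = Module.finrank ℝ E - 1 := by
  have h0 : ν ≠ 0 := by rintro rfl; simp at hν
  have := (ℝ ∙ ν).finrank_add_finrank_orthogonal
  rw [finrank_span_singleton h0] at this
  omega

variable [MeasurableSpace E] [BorelSpace E] (hG : IsGraphBox D p ν w r h g) (hν : ‖ν‖ = 1) {K : ℝ≥0}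
  (hK1 : ∀ y ∈ frontier D ∩ graphBox p ν w r h, ∀ z ∈ frontier D ∩ graphBox p ν w r h,
    ‖obliqueProj ν w (y - z)‖ ≤ K * ‖y - z‖)
  (hK2 : ∀ y ∈ frontier D ∩ graphBox p ν w r h, ∀ z ∈ frontier D ∩ graphBox p ν w r h,
    ‖y - z‖ ≤ K * ‖obliqueProj ν w (y - z)‖)

include hG hν hK2 in
omit [FiniteDimensional ℝ E] [MeasurableSpace E] [BorelSpace E] in
theorem IsGraphBox.lipschitzOnWith_graph :
    LipschitzOnWith K (fun y => p + slant ν w (g y, y)) (Metric.ball (0 : (ℝ ∙ ν)ᗮ) r) := by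
  refine LipschitzOnWith.of_dist_le_mul fun y hy z hz => ?_
  have hy' := hG.mem_frontier_inter hν (mem_ball_zero_iff.1 hy)
  have hz' := hG.mem_frontier_inter hν (mem_ball_zero_iff.1 hz)
  have := hK2 _ hy' _ hz'
  rwa [add_sub_add_left_eq_sub, map_sub, obliqueProj_slant hν, obliqueProj_slant hν,
    ← add_sub_add_left_eq_sub _ _ p, ← dist_eq_norm, ← dist_eq_norm] at this

include hG hν hK2 in
/-- The projection of the surface measure is at most `K ^ (n - 1)` times the Lebesgue measure. -/
theorem IsGraphBox.map_le :
    (((μHE[Module.finrank ℝ E - 1] : Measure E).restrict (frontier D)).restrict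
      (graphBox p ν w r h)).map (fun z => obliqueProj ν w (z - p))
    ≤ (K ^ (Module.finrank ℝ E - 1)) •
      (volume : Measure (ℝ ∙ ν)ᗮ).restrict (Metric.ball 0 r) := by
  have hπ : Measurable fun z => obliqueProj ν w (z - p) := by fun_prop
  refine Measure.le_iff.2 fun s hs => ?_
  rw [Measure.map_apply hπ hs, Measure.restrict_apply (hπ hs),
    Measure.restrict_apply ((hπ hs).inter isOpen_graphBox.measurableSet), Measure.smul_apply,
    Measure.restrict_apply hs, ← InnerProductSpace.euclideanHausdorffMeasure_eq_volume,
    finrank_orthogonal_eq hν]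
  refine (measure_mono ?_).trans (euclideanHausdorffMeasure_image_le
    ((hG.lipschitzOnWith_graph hν hK2).mono Set.inter_subset_right) _)
  rintro z ⟨⟨hzs, hzW⟩, hzf⟩
  exact ⟨_, ⟨hzs, mem_ball_zero_iff.2 hzW.2⟩, hG.eq_add_slant hν ⟨hzf, hzW⟩⟩

include hG hν hK1 in
/-- The Lebesgue measure is at most `K ^ (n - 1)` times the projection of the surface measure. -/
theorem IsGraphBox.le_map :
    (volume : Measure (ℝ ∙ ν)ᗮ).restrict (Metric.ball 0 r) ≤
    (K ^ (Module.finrank ℝ E - 1)) •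
    (((μHE[Module.finrank ℝ E - 1] : Measure E).restrict (frontier D)).restrict
      (graphBox p ν w r h)).map (fun z => obliqueProj ν w (z - p)) := by
  have hπ : Measurable fun z => obliqueProj ν w (z - p) := by fun_prop
  refine Measure.le_iff.2 fun s hs => ?_
  rw [Measure.smul_apply, Measure.map_apply hπ hs, Measure.restrict_apply (hπ hs),
    Measure.restrict_apply ((hπ hs).inter isOpen_graphBox.measurableSet),
    Measure.restrict_apply hs, ← InnerProductSpace.euclideanHausdorffMeasure_eq_volume,
    finrank_orthogonal_eq hν]
  have hL : LipschitzOnWith K (fun z => obliqueProj ν w (z - p))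
      ((fun z => obliqueProj ν w (z - p)) ⁻¹' s ∩ graphBox p ν w r h ∩ frontier D) := by
    refine LipschitzOnWith.of_dist_le_mul fun y hy z hz => ?_
    have := hK1 y ⟨hy.2, hy.1.2⟩ z ⟨hz.2, hz.1.2⟩
    rwa [dist_eq_norm, dist_eq_norm, ← map_sub, sub_sub_sub_cancel_right]
  refine (measure_mono ?_).trans (euclideanHausdorffMeasure_image_le hL _)
  rintro y ⟨hys, hyb⟩
  have hy := hG.mem_frontier_inter hν (mem_ball_zero_iff.1 hyb)
  have hpy : obliqueProj ν w (p + slant ν w (g y, y) - p) = y := by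
    rw [add_sub_cancel_left, obliqueProj_slant hν]
  refine ⟨p + slant ν w (g y, y), ⟨⟨?_, hy.2⟩, hy.1⟩, hpy⟩
  rw [Set.mem_preimage, hpy]
  exact hys

end Comparison

/-! ### The divergence theorem -/

section Local

open scoped NNReal

variable {n : ℕ} {D : Set (EuclideanSpace ℝ (Fin n))}

/-- Localized divergence theorem, up to a small error: near a boundary point `p` with outward
normal `ν`, the surface measure is almost the measure of the tangent hyperplane, transported along
the direction `ν + w`. -/
theorem exists_local_flux_estimate (F : Type*) [NormedAddCommGroup F] [NormedSpace ℝ F]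
    [CompleteSpace F] (hD : IsOpen D) (hb : Bornology.IsBounded D)
    {p ν : EuclideanSpace ℝ (Fin n)} (hp : p ∈ frontier D) (hν : IsOutwardUnitNormal D p ν)
    (w : (ℝ ∙ ν)ᗮ) {ε : ℝ} (hε : 0 < ε) {O : Set (EuclideanSpace ℝ (Fin n))} (hO : O ∈ nhds p) :
    ∃ W, IsOpen W ∧ p ∈ W ∧ W ⊆ O ∧ surfaceMeasure D W < ⊤ ∧
      ∀ u : EuclideanSpace ℝ (Fin n) → F, ContDiffOn ℝ 1 u (closure D) → tsupport u ⊆ W →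
        ‖(∫ z in D, fderiv ℝ u z (ν + w)) - ∫ y, u y ∂(surfaceMeasure D)‖
          ≤ ε * ∫ y, ‖u y‖ ∂(surfaceMeasure D) := by
  have hν1 := hν.norm_eq_one
  -- `K` is the bi-Lipschitz constant allowed for the projection of the boundary, and `η` the
  -- slope of boundary chords against the tangent hyperplane that guarantees it
  obtain ⟨K, hK1, hKε⟩ : ∃ K : ℝ≥0, 1 < K ∧ 3 * (((K ^ (n - 1) : ℝ≥0) : ℝ) - 1) < ε := by
    have hcont : Continuous fun K : ℝ≥0 => 3 * (((K ^ (n - 1) : ℝ≥0) : ℝ) - 1) := by fun_prop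
    have hev : ∀ᶠ K : ℝ≥0 in nhdsWithin 1 (Set.Ioi 1),
        3 * (((K ^ (n - 1) : ℝ≥0) : ℝ) - 1) < ε :=
      nhdsWithin_le_nhds ((hcont.tendsto 1).eventually_lt_const (by simpa using hε))
    obtain ⟨K, hK, hK'⟩ := (hev.and self_mem_nhdsWithin).exists
    exact ⟨K, hK', hK⟩
  have hK1' : (1 : ℝ) < K := by exact_mod_cast hK1
  obtain ⟨η, hη, hηS⟩ : ∃ η : ℝ, 0 < η ∧ η * ‖ν + (w : EuclideanSpace ℝ (Fin n))‖
      ≤ 1 - (K : ℝ)⁻¹ := by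
    have h1 : 0 < 1 - (K : ℝ)⁻¹ := sub_pos.2 (inv_lt_one_of_one_lt₀ hK1')
    set S := ‖ν + (w : EuclideanSpace ℝ (Fin n))‖
    have hS : 0 ≤ S := norm_nonneg _
    refine ⟨(1 - (K : ℝ)⁻¹) / (S + 1), by positivity, ?_⟩
    rw [div_mul_eq_mul_div, div_le_iff₀ (by positivity)]
    nlinarith
  obtain ⟨r, h, g, hr, hh, hG, hsub, hchord⟩ := exists_isGraphBox hD hp hν w hη hO
  have hB1 := fun y hy z hz => (norm_obliqueProj_bounds (w := w) hν1 hK1'.le hηS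
    (hchord y hy z hz)).1
  have hB2 := fun y hy z hz => (norm_obliqueProj_bounds (w := w) hν1 hK1'.le hηS
    (hchord y hy z hz)).2
  set W := graphBox p ν w r h with hW
  set π : EuclideanSpace ℝ (Fin n) → (ℝ ∙ ν)ᗮ := fun z => obliqueProj ν w (z - p) with hπ
  have hπm : Measurable π := by rw [hπ]; fun_prop
  set κ := ((surfaceMeasure D).restrict W).map π with hκ
  set lam := (volume : Measure (ℝ ∙ ν)ᗮ).restrict (Metric.ball 0 r) with hlam
  have hκle : κ ≤ (K ^ (n - 1)) • lam := by
    have := hG.map_le hν1 hB2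
    rwa [finrank_euclideanSpace_fin] at this
  have hlamle : lam ≤ (K ^ (n - 1)) • κ := by
    have := hG.le_map hν1 hB1
    rwa [finrank_euclideanSpace_fin] at this
  have hlamfin : IsFiniteMeasure lam := ⟨by
    rw [hlam, Measure.restrict_apply_univ]; exact measure_ball_lt_top⟩
  have hκfin : IsFiniteMeasure κ := isFiniteMeasure_of_le _ hκle
  have hσW : surfaceMeasure D W < ⊤ := by
    have := measure_lt_top κ Set.univ
    rwa [hκ, Measure.map_apply hπm MeasurableSet.univ, Set.preimage_univ,
      Measure.restrict_apply_univ] at this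
  refine ⟨W, isOpen_graphBox, self_mem_graphBox hr hh, hsub, hσW, ?_⟩
  intro u hu hsupp
  rw [hG.integral_fderiv_eq hν1 hD hb hu hsupp, ← hlam]
  set φ : (ℝ ∙ ν)ᗮ → F := fun y => u (p + slant ν w (g y, y)) with hφ
  have hφc : ContinuousOn φ (Metric.ball 0 r) :=
    hu.continuousOn.comp (hG.lipschitzOnWith_graph hν1 hB2).continuousOn fun y hy =>
      frontier_subset_closure (hG.mem_frontier_inter hν1 (mem_ball_zero_iff.1 hy)).1
  obtain ⟨C, hC⟩ := hb.isCompact_closure.exists_bound_of_continuousOn hu.continuousOn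
  have hφlam : Integrable φ lam := by
    refine IntegrableOn.of_bound measure_ball_lt_top
      (hφc.aestronglyMeasurable measurableSet_ball) C ?_
    refine (ae_restrict_iff' measurableSet_ball).2 (Filter.Eventually.of_forall fun y hy => ?_)
    exact hC _ (frontier_subset_closure (hG.mem_frontier_inter hν1 (mem_ball_zero_iff.1 hy)).1)
  have hφκ : Integrable φ κ := (hφlam.smul_measure_nnreal (c := K ^ (n - 1))).mono_measure hκle
  have hae : ∀ᵐ z ∂((surfaceMeasure D).restrict W), φ (π z) = u z := by
    have h1 : ∀ᵐ z ∂((surfaceMeasure D).restrict W), z ∈ frontier D :=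
      ae_restrict_of_ae (ae_restrict_mem isClosed_frontier.measurableSet)
    filter_upwards [h1, ae_restrict_mem isOpen_graphBox.measurableSet] with z hz hzW
    rw [hφ, hπ]
    simp only
    rw [hG.eq_add_slant hν1 ⟨hz, hzW⟩]
  have hzero : ∀ z, z ∉ W → u z = 0 := fun z hz =>
    image_eq_zero_of_notMem_tsupport fun hzs => hz (hsupp hzs)
  have e1 : ∫ y, φ y ∂κ = ∫ y, u y ∂(surfaceMeasure D) := by
    rw [hκ, integral_map hπm.aemeasurable hφκ.aestronglyMeasurable, integral_congr_ae hae]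
    exact setIntegral_eq_integral_of_forall_compl_eq_zero hzero
  have e2 : ∫ y, ‖φ y‖ ∂κ = ∫ y, ‖u y‖ ∂(surfaceMeasure D) := by
    rw [hκ, integral_map hπm.aemeasurable hφκ.aestronglyMeasurable.norm,
      integral_congr_ae (hae.mono fun z hz => congrArg norm hz)]
    exact setIntegral_eq_integral_of_forall_compl_eq_zero fun z hz => by rw [hzero z hz, norm_zero]
  rw [← e1, ← e2]
  refine (norm_integral_sub_integral_le (one_le_pow₀ hK1.le) hlamle hκle hφκ).trans ?_
  exact mul_le_mul_of_nonneg_right hKε.le (integral_nonneg fun _ => norm_nonneg _)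

/-- The outward unit normal is continuous along a smooth boundary. -/
theorem continuousOn_outwardUnitNormal (hs : HasSmoothBoundary D) :
    ContinuousOn (outwardUnitNormal D) (frontier D) := by
  intro p hp
  obtain ⟨U, ρ, hpU, h⟩ := hs p hp
  have hgrad : ContinuousOn (gradient ρ) U :=
    (LinearIsometryEquiv.continuous _).comp_continuousOn
      (h.contDiffOn.continuousOn_fderiv_of_isOpen h.isOpen (by simp))
  have hn : ContinuousOn (fun y => ‖gradient ρ y‖⁻¹ • gradient ρ y) U :=
    (hgrad.norm.inv₀ fun y hy => norm_ne_zero_iff.2 (h.gradient_ne_zero y hy)).smul hgrad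
  have heq : ∀ y ∈ frontier D ∩ U, outwardUnitNormal D y = ‖gradient ρ y‖⁻¹ • gradient ρ y :=
    fun y hy => IsOutwardUnitNormal.unique hy.1 (isOutwardUnitNormal_outwardUnitNormal hs hy.1)
      ⟨U, ρ, hy.2, h, rfl⟩
  have h1 : ContinuousWithinAt (outwardUnitNormal D) (frontier D ∩ U) p :=
    (hn.mono Set.inter_subset_right p ⟨hp, hpU⟩).congr heq (heq p ⟨hp, hpU⟩)
  exact h1.mono_of_mem_nhdsWithin (inter_mem_nhdsWithin _ (h.isOpen.mem_nhds hpU))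

/-- A compact smooth boundary has finite area, since this is so locally. -/
theorem isFiniteMeasure_surfaceMeasure (hD : IsOpen D) (hb : Bornology.IsBounded D)
    (hs : HasSmoothBoundary D) : IsFiniteMeasure (surfaceMeasure D) := by
  have hc : IsCompact (frontier D) :=
    hb.isCompact_closure.of_isClosed_subset isClosed_frontier frontier_subset_closure
  have h1 : surfaceMeasure D (frontier D) < ⊤ := by
    refine hc.measure_lt_top_of_nhdsWithin fun p hp => ?_
    obtain ⟨W, hW, hpW, -, hfin, -⟩ := exists_local_flux_estimate ℝ hD hb hp
      (isOutwardUnitNormal_outwardUnitNormal hs hp) 0 one_pos Filter.univ_mem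
    exact ⟨W, mem_nhdsWithin_of_mem_nhds (hW.mem_nhds hpW), hfin⟩
  refine ⟨?_⟩
  rw [surfaceMeasure, Measure.restrict_apply_univ]
  rwa [surfaceMeasure, Measure.restrict_apply_self] at h1

end Local

section Global

variable {n : ℕ} {D : Set (EuclideanSpace ℝ (Fin n))}
  {F : Type*} [NormedAddCommGroup F] [NormedSpace ℝ F]

omit [NormedSpace ℝ F] in
theorem integrable_surfaceMeasure (hD : IsOpen D) (hb : Bornology.IsBounded D)
    (hs : HasSmoothBoundary D) {φ : EuclideanSpace ℝ (Fin n) → F}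
    (hφ : ContinuousOn φ (frontier D)) : Integrable φ (surfaceMeasure D) := by
  have hfin := isFiniteMeasure_surfaceMeasure hD hb hs
  have hc : IsCompact (frontier D) :=
    hb.isCompact_closure.of_isClosed_subset isClosed_frontier frontier_subset_closure
  obtain ⟨C, hC⟩ := hc.exists_bound_of_continuousOn hφ
  refine Integrable.of_bound (hφ.aestronglyMeasurable isClosed_frontier.measurableSet) C ?_
  exact (ae_restrict_iff' isClosed_frontier.measurableSet).2 (Filter.Eventually.of_forall hC)

/-- The deviation from the divergence theorem in the direction `v`. -/
noncomputable def fluxDefect (D : Set (EuclideanSpace ℝ (Fin n))) (v : EuclideanSpace ℝ (Fin n))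
    (u : EuclideanSpace ℝ (Fin n) → F) : F :=
  (∫ z in D, fderiv ℝ u z v) - ∫ y, inner ℝ (outwardUnitNormal D y) v • u y ∂(surfaceMeasure D)

/-- The interior case of the divergence theorem: there is no boundary term for compactly supported
functions. -/
theorem setIntegral_fderiv_eq_zero (hD : IsOpen D) (hb : Bornology.IsBounded D)
    {u : EuclideanSpace ℝ (Fin n) → F} (hu : ContDiffOn ℝ 1 u (closure D)) (hsupp : tsupport u ⊆ D)
    (v : EuclideanSpace ℝ (Fin n)) : ∫ z in D, fderiv ℝ u z v = 0 := by
  have hdiff : ∀ z, HasFDerivAt u (fderiv ℝ u z) z := by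
    intro z
    by_cases hz : z ∈ D
    · exact (differentiableAt_of_contDiffOn_closure hD hu hz).hasFDerivAt
    · have h0 : u =ᶠ[nhds z] 0 := notMem_tsupport_iff_eventuallyEq.1 fun h => hz (hsupp h)
      exact (((hasFDerivAt_const (0 : F) z).congr_of_eventuallyEq h0).differentiableAt).hasFDerivAt
  have h0 : ∀ z, z ∉ D → fderiv ℝ u z v = 0 := fun z hz => by
    rw [fderiv_of_notMem_tsupport ℝ fun h => hz (hsupp h)]; rfl
  have h0' : ∀ z, z ∉ D → u z = 0 := fun z hz =>
    image_eq_zero_of_notMem_tsupport fun h => hz (hsupp h)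
  have hi : Integrable (fun z => fderiv ℝ u z v) :=
    (integrableOn_iff_integrable_of_support_subset
      fun z hz => by_contra fun h => hz (h0 z h)).1 (integrableOn_fderiv_apply hD hb hu v)
  have hui : Integrable u :=
    (integrableOn_iff_integrable_of_support_subset
      fun z hz => by_contra fun h => hz (h0' z h)).1
      ((hu.continuousOn.integrableOn_compact hb.isCompact_closure).mono_set subset_closure)
  rw [setIntegral_eq_integral_of_forall_compl_eq_zero h0]
  have := integral_bilinear_hasFDerivAt_right_eq_neg_left_of_integrable
    (μ := (volume : Measure (EuclideanSpace ℝ (Fin n)))) (v := v)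
    (f := fun _ => (1 : ℝ)) (f' := fun _ => 0) (g := u) (g' := fderiv ℝ u)
    (B := ContinuousLinearMap.lsmul ℝ ℝ) (by simp) (by simpa using hi) (by simpa using hui)
    (fun x _ => hasFDerivAt_const _ _) (fun x _ => hdiff x)
  simpa using this

/-- Near every point of the closure the divergence theorem holds up to a small error. At a boundary
point the normal component of `v` is split off, so that only directions transversal to the boundary
are needed. -/
theorem exists_norm_fluxDefect_le (F : Type*) [NormedAddCommGroup F] [NormedSpace ℝ F]
    [CompleteSpace F] (hD : IsOpen D) (hb : Bornology.IsBounded D)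
    (hs : HasSmoothBoundary D) (v : EuclideanSpace ℝ (Fin n)) {ε : ℝ} (hε : 0 < ε)
    {p : EuclideanSpace ℝ (Fin n)} (hp : p ∈ closure D) :
    ∃ W, IsOpen W ∧ p ∈ W ∧ ∀ u : EuclideanSpace ℝ (Fin n) → F, ContDiffOn ℝ 1 u (closure D) →
      tsupport u ⊆ W → ‖fluxDefect D v u‖ ≤ ε * ∫ y, ‖u y‖ ∂(surfaceMeasure D) := by
  by_cases hpD : p ∈ D
  · refine ⟨D, hD, hpD, fun u hu hsupp => ?_⟩
    have h2 : ∫ y, inner ℝ (outwardUnitNormal D y) v • u y ∂(surfaceMeasure D) = 0 := by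
      refine setIntegral_eq_zero_of_forall_eq_zero fun y hy => ?_
      rw [hD.frontier_eq] at hy
      rw [image_eq_zero_of_notMem_tsupport fun h => hy.2 (hsupp h), smul_zero]
    rw [fluxDefect, setIntegral_fderiv_eq_zero hD hb hu hsupp, h2, sub_zero, norm_zero]
    exact mul_nonneg hε.le (integral_nonneg fun _ => norm_nonneg _)
  have hpf : p ∈ frontier D := by rw [hD.frontier_eq]; exact ⟨hp, hpD⟩
  have hν := isOutwardUnitNormal_outwardUnitNormal hs hpf
  have hνc := continuousOn_outwardUnitNormal hs
  set ν := outwardUnitNormal D p with hνdef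
  have hν1 : ‖ν‖ = 1 := hν.norm_eq_one
  set α : ℝ := inner ℝ ν v with hα
  -- `v` is a combination of two directions transversal to the boundary
  obtain ⟨w, hw⟩ : ∃ w : (ℝ ∙ ν)ᗮ, v = (α - 1) • ν + (ν + (w : EuclideanSpace ℝ (Fin n))) := by
    refine ⟨⟨v - α • ν, ?_⟩, ?_⟩
    · rw [Submodule.mem_orthogonal_singleton_iff_inner_right, inner_sub_right, inner_smul_right,
        real_inner_self_eq_norm_sq, hν1]
      simp [hα]
    · simp only [sub_smul, one_smul]; abel
  set ε' := ε / (2 * (|α - 1| + 1)) with hε'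
  have hε'0 : 0 < ε' := by positivity
  have hε'e : |α - 1| * ε' + ε' = ε / 2 := by rw [hε']; field_simp
  obtain ⟨O, hO, hpO, hOν⟩ : ∃ O, IsOpen O ∧ p ∈ O ∧ ∀ y ∈ O ∩ frontier D,
      |α - inner ℝ (outwardUnitNormal D y) v| < ε / 2 := by
    have hc : ContinuousOn (fun y => |α - inner ℝ (outwardUnitNormal D y) v|) (frontier D) :=
      (continuousOn_const.sub (hνc.inner continuousOn_const)).abs
    have hlim : Filter.Tendsto (fun y => |α - inner ℝ (outwardUnitNormal D y) v|)
        (nhdsWithin p (frontier D)) (nhds |α - inner ℝ ν v|) := hc p hpf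
    rw [← hα, sub_self, abs_zero] at hlim
    exact mem_nhdsWithin.1 (hlim.eventually_lt_const (half_pos hε))
  obtain ⟨W₁, hW₁, hpW₁, hW₁O, -, h₁⟩ := exists_local_flux_estimate F hD hb hpf hν 0 hε'0
    (hO.mem_nhds hpO)
  obtain ⟨W₂, hW₂, hpW₂, -, -, h₂⟩ := exists_local_flux_estimate F hD hb hpf hν w hε'0
    Filter.univ_mem
  refine ⟨W₁ ∩ W₂, hW₁.inter hW₂, ⟨hpW₁, hpW₂⟩, fun u hu hsupp => ?_⟩
  have g₁ := h₁ u hu (hsupp.trans Set.inter_subset_left)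
  have g₂ := h₂ u hu (hsupp.trans Set.inter_subset_right)
  rw [Submodule.coe_zero, add_zero] at g₁
  have huf : ContinuousOn u (frontier D) := hu.continuousOn.mono frontier_subset_closure
  have hui : Integrable u (surfaceMeasure D) := integrable_surfaceMeasure hD hb hs huf
  have hui' : Integrable (fun y => inner ℝ (outwardUnitNormal D y) v • u y) (surfaceMeasure D) :=
    integrable_surfaceMeasure hD hb hs ((hνc.inner continuousOn_const).smul huf)
  set I := ∫ y, u y ∂(surfaceMeasure D) with hI
  set N := ∫ y, ‖u y‖ ∂(surfaceMeasure D) with hN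
  have e1 : ∫ z in D, fderiv ℝ u z v = (α - 1) • (∫ z in D, fderiv ℝ u z ν)
      + ∫ z in D, fderiv ℝ u z (ν + w) := by
    have hi : IntegrableOn (fun z => (α - 1) • fderiv ℝ u z ν) D :=
      (integrableOn_fderiv_apply hD hb hu _).smul _
    rw [← integral_smul, ← integral_add hi (integrableOn_fderiv_apply hD hb hu _)]
    refine integral_congr_ae (Filter.Eventually.of_forall fun z => ?_)
    change fderiv ℝ u z v = (α - 1) • fderiv ℝ u z ν + fderiv ℝ u z (ν + w)
    rw [← map_smul, ← map_add, ← hw]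
  have e2 : ‖∫ y, (α - inner ℝ (outwardUnitNormal D y) v) • u y ∂(surfaceMeasure D)‖
      ≤ ε / 2 * N := by
    rw [hN, ← integral_const_mul]
    refine norm_integral_le_of_norm_le (hui.norm.const_mul _) ?_
    refine (ae_restrict_iff' isClosed_frontier.measurableSet).2
      (Filter.Eventually.of_forall fun y hy => ?_)
    by_cases hyW : y ∈ W₁
    · rw [norm_smul, Real.norm_eq_abs]
      exact mul_le_mul_of_nonneg_right (hOν y ⟨hW₁O hyW, hy⟩).le (norm_nonneg _)
    · rw [image_eq_zero_of_notMem_tsupport fun h => hyW (hsupp h).1]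
      simp
  have e3 : ∫ y, (α - inner ℝ (outwardUnitNormal D y) v) • u y ∂(surfaceMeasure D)
      = α • I - ∫ y, inner ℝ (outwardUnitNormal D y) v • u y ∂(surfaceMeasure D) := by
    have hiα : Integrable (fun y => α • u y) (surfaceMeasure D) := hui.smul α
    simp_rw [sub_smul]
    rw [integral_sub hiα hui', integral_smul]
  have key : fluxDefect D v u = (α - 1) • ((∫ z in D, fderiv ℝ u z ν) - I)
      + ((∫ z in D, fderiv ℝ u z (ν + w)) - I)
      + ∫ y, (α - inner ℝ (outwardUnitNormal D y) v) • u y ∂(surfaceMeasure D) := by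
    rw [fluxDefect, e1, e3, smul_sub, sub_smul _ _ I, one_smul]
    abel
  rw [key]
  calc _ ≤ |α - 1| * (ε' * N) + ε' * N + ε / 2 * N := by
        refine (norm_add₃_le).trans (add_le_add (add_le_add ?_ g₂) e2)
        rw [norm_smul, Real.norm_eq_abs]
        exact mul_le_mul_of_nonneg_left g₁ (abs_nonneg _)
    _ = (|α - 1| * ε' + ε') * N + ε / 2 * N := by ring
    _ = ε * N := by rw [hε'e]; ring

open scoped Manifold in
/-- The divergence theorem in the direction `v`: the local errors add up, by a partition of unity,
to an arbitrarily small multiple of `∫ ‖u‖ dσ`. -/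
theorem fluxDefect_eq_zero [CompleteSpace F] (hD : IsOpen D) (hb : Bornology.IsBounded D)
    (hs : HasSmoothBoundary D) (v : EuclideanSpace ℝ (Fin n))
    {u : EuclideanSpace ℝ (Fin n) → F} (hu : ContDiffOn ℝ 1 u (closure D)) :
    fluxDefect D v u = 0 := by
  suffices h : ∀ ε > 0, ‖fluxDefect D v u‖ ≤ ε * ∫ y, ‖u y‖ ∂(surfaceMeasure D) by
    have hlim : Filter.Tendsto (fun ε : ℝ => ε * ∫ y, ‖u y‖ ∂(surfaceMeasure D))
        (nhdsWithin 0 (Set.Ioi 0)) (nhds 0) := by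
      have : Continuous fun ε : ℝ => ε * ∫ y, ‖u y‖ ∂(surfaceMeasure D) := by fun_prop
      simpa using (this.tendsto 0).mono_left nhdsWithin_le_nhds
    exact norm_le_zero_iff.1 (ge_of_tendsto hlim
      (Filter.eventually_of_mem self_mem_nhdsWithin fun ε hε => h ε hε))
  intro ε hε
  have hW : ∀ p, ∃ W, p ∈ closure D → IsOpen W ∧ p ∈ W ∧
      ∀ u : EuclideanSpace ℝ (Fin n) → F, ContDiffOn ℝ 1 u (closure D) →
      tsupport u ⊆ W → ‖fluxDefect D v u‖ ≤ ε * ∫ y, ‖u y‖ ∂(surfaceMeasure D) := by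
    intro p
    by_cases hp : p ∈ closure D
    · obtain ⟨W, h⟩ := exists_norm_fluxDefect_le F hD hb hs v hε hp
      exact ⟨W, fun _ => h⟩
    · exact ⟨∅, fun h => absurd h hp⟩
  choose W hW using hW
  obtain ⟨t, ht, hcover⟩ := hb.isCompact_closure.elim_nhds_subcover W
    fun p hp => (hW p hp).1.mem_nhds (hW p hp).2.1
  obtain ⟨f, hf⟩ := SmoothPartitionOfUnity.exists_isSubordinate
    𝓘(ℝ, EuclideanSpace ℝ (Fin n)) (s := closure D) isClosed_closure (fun i : t => W i)
    (fun i => (hW i (ht i i.2)).1) (by rwa [← Set.iUnion_subtype (· ∈ t) fun i => W i] at hcover)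
  have hf1 : ∀ z ∈ closure D, ∑ i, f i z = 1 := fun z hz => by
    rw [← finsum_eq_sum_of_fintype]; exact f.sum_eq_one hz
  have hfu : ∀ i, ContDiffOn ℝ 1 (fun z => f i z • u z) (closure D) := fun i =>
    (((f i).contMDiff.contDiff.of_le (by simp)).contDiffOn).smul hu
  have huf : ContinuousOn u (frontier D) := hu.continuousOn.mono frontier_subset_closure
  have hνc := continuousOn_outwardUnitNormal hs
  have hfuf : ∀ i, ContinuousOn (fun z => f i z • u z) (frontier D) := fun i =>
    (hfu i).continuousOn.mono frontier_subset_closure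
  have hsum : ∀ z ∈ closure D, ∑ i, f i z • u z = u z := fun z hz => by
    rw [← Finset.sum_smul, hf1 z hz, one_smul]
  have e1 : ∫ z in D, fderiv ℝ u z v = ∑ i, ∫ z in D, fderiv ℝ (fun z => f i z • u z) z v := by
    rw [← integral_finsetSum _ fun i _ => integrableOn_fderiv_apply hD hb (hfu i) v]
    refine setIntegral_congr_fun hD.measurableSet fun z hz => ?_
    have heq : u =ᶠ[nhds z] fun z => ∑ i, f i z • u z :=
      Filter.eventually_of_mem (hD.mem_nhds hz) fun y hy => (hsum y (subset_closure hy)).symm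
    rw [heq.fderiv_eq, fderiv_fun_sum fun i _ =>
      differentiableAt_of_contDiffOn_closure hD (hfu i) hz, _root_.sum_apply]
  have hae : ∀ᵐ y ∂(surfaceMeasure D), y ∈ frontier D :=
    ae_restrict_mem isClosed_frontier.measurableSet
  have e2 : ∫ y, inner ℝ (outwardUnitNormal D y) v • u y ∂(surfaceMeasure D)
      = ∑ i, ∫ y, inner ℝ (outwardUnitNormal D y) v • (f i y • u y) ∂(surfaceMeasure D) := by
    have hi : ∀ i, Integrable (fun y => inner ℝ (outwardUnitNormal D y) v • (f i y • u y))
        (surfaceMeasure D) := fun i =>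
      integrable_surfaceMeasure hD hb hs ((hνc.inner continuousOn_const).smul (hfuf i))
    rw [← integral_finsetSum _ fun i _ => hi i]
    refine integral_congr_ae (hae.mono fun y hy => ?_)
    simp only
    rw [← Finset.smul_sum, hsum y (frontier_subset_closure hy)]
  have e3 : ∫ y, ‖u y‖ ∂(surfaceMeasure D) = ∑ i, ∫ y, ‖f i y • u y‖ ∂(surfaceMeasure D) := by
    rw [← integral_finsetSum _ fun i _ => integrable_surfaceMeasure hD hb hs (hfuf i).norm]
    refine integral_congr_ae (hae.mono fun y hy => ?_)
    simp only [norm_smul, Real.norm_eq_abs, abs_of_nonneg (f.nonneg _ _)]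
    rw [← Finset.sum_mul, hf1 y (frontier_subset_closure hy), one_mul]
  have e4 : fluxDefect D v u = ∑ i, fluxDefect D v (fun z => f i z • u z) := by
    simp only [fluxDefect]
    rw [Finset.sum_sub_distrib, e1, e2]
  rw [e4, e3, Finset.mul_sum]
  refine norm_sum_le_of_le _ fun i _ => (hW i (ht i i.2)).2.2 _ (hfu i) ?_
  exact (tsupport_smul_subset_left _ _).trans (hf i)

/-- The divergence theorem for a bounded open set with smooth boundary and a vector field of class
`C¹` up to the boundary, with respect to the Hausdorff surface measure. -/
theorem integral_divergence_eq_integral_flux [CompleteSpace F] (hD : IsOpen D)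
    (hb : Bornology.IsBounded D) (hs : HasSmoothBoundary D)
    {X : EuclideanSpace ℝ (Fin n) → Fin n → F}
    (hX : ∀ j, ContDiffOn ℝ 1 (fun y => X y j) (closure D)) :
    ∫ z in D, ∑ j, fderiv ℝ (fun y => X y j) z (EuclideanSpace.single j 1)
      = ∫ y, ∑ j, outwardUnitNormal D y j • X y j ∂(surfaceMeasure D) := by
  have hνc := continuousOn_outwardUnitNormal hs
  have hin : ∀ y j, inner ℝ (outwardUnitNormal D y) (EuclideanSpace.single j (1 : ℝ))
      = outwardUnitNormal D y j := by
    intro y j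
    simp [EuclideanSpace.inner_single_right]
  rw [integral_finsetSum _ fun j _ => integrableOn_fderiv_apply hD hb (hX j) _,
    integral_finsetSum]
  · refine Finset.sum_congr rfl fun j _ => ?_
    have := fluxDefect_eq_zero hD hb hs (EuclideanSpace.single j 1) (hX j)
    rw [fluxDefect, sub_eq_zero] at this
    simpa only [hin] using this
  · intro j _
    refine integrable_surfaceMeasure hD hb hs (ContinuousOn.smul ?_
      ((hX j).continuousOn.mono frontier_subset_closure))
    exact (EuclideanSpace.proj (𝕜 := ℝ) j).continuous.comp_continuousOn hνc

end Global

/-! ### The regularized kernel -/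

section Peak

open Filter Topology

/-- The radial profile `(1 + |u|²)^(-n/2-1) / Vol`, whose rescalings are an approximate
identity. -/
noncomputable def peak (n : ℕ) (u : EuclideanSpace ℝ (Fin n)) : ℝ :=
  (ballVol n)⁻¹ * (1 + ‖u‖ ^ 2) ^ (-((n : ℝ) / 2) - 1)

theorem peak_nonneg (n : ℕ) (u : EuclideanSpace ℝ (Fin n)) : 0 ≤ peak n u :=
  mul_nonneg (inv_nonneg.2 (ballVol_pos n).le) (by positivity)

theorem integral_radial_eq_inv {n : ℕ} (hn : 0 < n) :
    ∫ t in Set.Ioi (0 : ℝ), t ^ (n - 1) • (1 + t ^ 2) ^ (-((n : ℝ) / 2) - 1) = (n : ℝ)⁻¹ := by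
  have hn' : (n : ℝ) ≠ 0 := by positivity
  -- an antiderivative is `t ^ n * (1 + t ^ 2) ^ (-n/2)`, up to the factor `n`
  have hd : ∀ t ∈ Set.Ioi (0 : ℝ), HasDerivAt
      (fun t : ℝ => (n : ℝ)⁻¹ * (t ^ n * (1 + t ^ 2) ^ (-((n : ℝ) / 2))))
      (t ^ (n - 1) • (1 + t ^ 2) ^ (-((n : ℝ) / 2) - 1)) t := by
    intro t ht
    have h0 : 0 < 1 + t ^ 2 := by positivity
    have h1 : HasDerivAt (fun t : ℝ => 1 + t ^ 2) (2 * t) t := by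
      simpa using (hasDerivAt_pow 2 t).const_add 1
    have h2 := ((hasDerivAt_pow n t).mul
      (h1.rpow_const (p := -((n : ℝ) / 2)) (Or.inl h0.ne'))).const_mul (n : ℝ)⁻¹
    refine h2.congr_deriv (Eq.symm ?_)
    have h3 : (1 + t ^ 2) ^ (-((n : ℝ) / 2))
        = (1 + t ^ 2) * (1 + t ^ 2) ^ (-((n : ℝ) / 2) - 1) := by
      rw [Real.rpow_sub_one h0.ne']; field_simp
    obtain ⟨m, rfl⟩ : ∃ m, n = m + 1 := ⟨n - 1, by omega⟩
    rw [h3, smul_eq_mul, Nat.add_sub_cancel]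
    field_simp
    ring
  have hc : Continuous (fun t : ℝ => (n : ℝ)⁻¹ * (t ^ n * (1 + t ^ 2) ^ (-((n : ℝ) / 2)))) := by
    refine continuous_const.mul ((continuous_pow n).mul (Continuous.rpow_const (by fun_prop) ?_))
    intro t
    exact Or.inl (by positivity)
  have hlim : Tendsto (fun t : ℝ => (n : ℝ)⁻¹ * (t ^ n * (1 + t ^ 2) ^ (-((n : ℝ) / 2)))) atTop
      (𝓝 (n : ℝ)⁻¹) := by
    have h1 : Tendsto (fun t : ℝ => ((t ^ 2)⁻¹ + 1) ^ (-((n : ℝ) / 2))) atTop (𝓝 1) := by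
      have h2 : Tendsto (fun t : ℝ => (t ^ 2)⁻¹ + 1) atTop (𝓝 (0 + 1)) :=
        (tendsto_inv_atTop_zero.comp (tendsto_pow_atTop two_ne_zero)).add_const 1
      have h3 := h2.rpow_const (p := -((n : ℝ) / 2)) (Or.inl (by norm_num))
      simpa using h3
    have h4 := h1.const_mul (n : ℝ)⁻¹
    rw [mul_one] at h4
    refine h4.congr' ?_
    filter_upwards [eventually_gt_atTop 0] with t ht
    have e1 : t ^ n = (t ^ 2) ^ ((n : ℝ) / 2) := by
      rw [← Real.rpow_natCast t 2, ← Real.rpow_mul ht.le, ← Real.rpow_natCast]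
      congr 1
      push_cast
      ring
    have e2 : (1 + t ^ 2) = t ^ 2 * ((t ^ 2)⁻¹ + 1) := by field_simp
    have e3 : 0 < (t ^ 2) ^ ((n : ℝ) / 2) := by positivity
    rw [e1, e2, Real.mul_rpow (by positivity) (by positivity),
      Real.rpow_neg (by positivity : 0 ≤ t ^ 2), mul_inv_cancel_left₀ e3.ne']
  have := integral_Ioi_of_hasDerivAt_of_nonneg hc.continuousWithinAt hd
    (fun t (ht : 0 < t) => by positivity) hlim
  rw [this]
  simp [hn.ne']

theorem integral_peak {n : ℕ} (hn : 0 < n) : ∫ u, peak n u = 1 := by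
  have : Nonempty (Fin n) := ⟨⟨0, hn⟩⟩
  have hV := (ballVol_pos n).ne'
  have hn' : (n : ℝ) ≠ 0 := by positivity
  simp only [peak]
  rw [integral_const_mul, integral_fun_norm_addHaar volume
    fun t : ℝ => (1 + t ^ 2) ^ (-((n : ℝ) / 2) - 1), finrank_euclideanSpace_fin,
    integral_radial_eq_inv hn, smul_eq_mul, nsmul_eq_mul]
  change (ballVol n)⁻¹ * (n * (ballVol n * (n : ℝ)⁻¹)) = 1
  field_simp

theorem tendsto_norm_pow_mul_peak (n : ℕ) :
    Tendsto (fun u => ‖u‖ ^ n * peak n u) (Bornology.cobounded (EuclideanSpace ℝ (Fin n)))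
      (𝓝 0) := by
  have hV := ballVol_pos n
  have hlim : Tendsto (fun u : EuclideanSpace ℝ (Fin n) => (ballVol n)⁻¹ * (1 + ‖u‖ ^ 2)⁻¹)
      (Bornology.cobounded _) (𝓝 0) := by
    have h1 : Tendsto (fun t : ℝ => 1 + t ^ 2) atTop atTop :=
      tendsto_atTop_add_const_left _ _ (tendsto_pow_atTop two_ne_zero)
    simpa using ((tendsto_inv_atTop_zero.comp h1).comp tendsto_norm_cobounded_atTop).const_mul
      (ballVol n)⁻¹
  refine squeeze_zero (fun u => mul_nonneg (by positivity) (peak_nonneg n u)) (fun u => ?_) hlim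
  have h0 : 0 < 1 + ‖u‖ ^ 2 := by positivity
  have e1 : ‖u‖ ^ n ≤ (1 + ‖u‖ ^ 2) ^ ((n : ℝ) / 2) := by
    calc ‖u‖ ^ n = (‖u‖ ^ 2) ^ ((n : ℝ) / 2) := by
          rw [← Real.rpow_natCast ‖u‖ 2, ← Real.rpow_mul (norm_nonneg _), ← Real.rpow_natCast]
          congr 1
          push_cast
          ring
      _ ≤ _ := Real.rpow_le_rpow (by positivity) (by linarith) (by positivity)
  calc ‖u‖ ^ n * peak n u
      ≤ (1 + ‖u‖ ^ 2) ^ ((n : ℝ) / 2) * peak n u := by gcongr; exact peak_nonneg n u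
    _ = _ := by
      rw [peak, Real.rpow_sub_one h0.ne', Real.rpow_neg h0.le]
      have : (1 + ‖u‖ ^ 2) ^ ((n : ℝ) / 2) ≠ 0 := (by positivity : (0 : ℝ) < _).ne'
      field_simp

/-- The rescalings of `peak` are the densities produced by the regularized kernel with
`s = c⁻²`. -/
theorem pow_mul_peak_smul {n : ℕ} {c : ℝ} (hc : 0 < c) (z : EuclideanSpace ℝ (Fin n)) :
    c ^ n * peak n (c • z)
      = (ballVol n)⁻¹ * ((c⁻¹) ^ 2 * (‖z‖ ^ 2 + (c⁻¹) ^ 2) ^ (-((n : ℝ) / 2) - 1)) := by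
  have h1 : ‖z‖ ^ 2 + (c⁻¹) ^ 2 = (c⁻¹) ^ 2 * (1 + ‖c • z‖ ^ 2) := by
    rw [norm_smul, Real.norm_of_nonneg hc.le]
    field_simp
    ring
  have h2 : ((c⁻¹) ^ 2) ^ (-((n : ℝ) / 2) - 1) = c ^ n * c ^ 2 := by
    rw [inv_pow, Real.inv_rpow (by positivity), ← Real.rpow_neg (by positivity),
      ← Real.rpow_natCast c 2, ← Real.rpow_mul hc.le, ← Real.rpow_natCast c n, ← Real.rpow_add hc]
    congr 1
    push_cast
    ring
  rw [h1, Real.mul_rpow (by positivity) (by positivity), h2, peak]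
  field_simp

end Peak

section Kernel

variable {n q : ℕ} {A : Type*} [NormedCommRing A] [NormedAlgebra ℝ A]
  {a b : Matrix (Fin n) (Fin q) A}

/-- The linear form `z ↦ ∑ m, a^j_m ∑ i, b^i_m z_i`. -/
noncomputable def kernelForm (a b : Matrix (Fin n) (Fin q) A) (j : Fin n) :
    EuclideanSpace ℝ (Fin n) →L[ℝ] A :=
  ∑ i, (EuclideanSpace.proj (𝕜 := ℝ) i).smulRight (∑ m, a j m * b i m)

theorem kernelForm_apply (j : Fin n) (z : EuclideanSpace ℝ (Fin n)) :
    kernelForm a b j z = ∑ i, z i • ∑ m, a j m * b i m := by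
  simp [kernelForm, _root_.sum_apply]

theorem kernelForm_eq (j : Fin n) (x y : EuclideanSpace ℝ (Fin n)) :
    kernelForm a b j (y - x) = ∑ m, a j m * kernelNumerator b m x y := by
  simp only [kernelForm_apply, kernelNumerator, Finset.mul_sum, Finset.smul_sum]
  rw [Finset.sum_comm]
  simp

theorem kernelForm_single (h : SolvesKernelSystem a b) (j : Fin n) :
    kernelForm a b j (EuclideanSpace.single j 1) = ((n : ℝ) * ballVol n)⁻¹ • (1 : A) := by
  rw [kernelForm_apply, Finset.sum_eq_single j]
  · simpa using h.1 j
  · intro i _ hij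
    simp [hij]
  · simp

/-- Only the symmetric part of the coefficients `∑ m, a^j_m b^i_m` contributes in the radial
direction, and it is scalar. -/
theorem sum_smul_kernelForm (h : SolvesKernelSystem a b) (z : EuclideanSpace ℝ (Fin n)) :
    ∑ j, z j • kernelForm a b j z = (‖z‖ ^ 2 * ((n : ℝ) * ballVol n)⁻¹) • (1 : A) := by
  set S : Fin n → Fin n → A := fun j i => ∑ m, a j m * b i m with hS
  set κ := ((n : ℝ) * ballVol n)⁻¹ with hκ
  have e1 : ∑ j, z j • kernelForm a b j z = ∑ j, ∑ i, (z j * z i) • S j i := by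
    simp only [kernelForm_apply, hS, Finset.smul_sum, smul_smul]
  have e2 : ∑ j, ∑ i, (z j * z i) • S j i = ∑ j, ∑ i, (z j * z i) • S i j := by
    rw [Finset.sum_comm]
    simp only [mul_comm]
  have e3 : ∀ j i, S j i + S i j = if i = j then (2 * κ) • (1 : A) else 0 := by
    intro j i
    split_ifs with hij
    · subst hij
      simp only [hS]
      rw [h.1 i, ← hκ, ← add_smul, two_mul]
    · simp only [hS]
      rw [← Finset.sum_add_distrib]
      exact h.2 i j hij
  have e4 : (2 : ℝ) • ∑ j, ∑ i, (z j * z i) • S j i = (2 : ℝ) • ((‖z‖ ^ 2 * κ) • (1 : A)) := by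
    rw [two_smul]
    nth_rewrite 2 [e2]
    simp only [← Finset.sum_add_distrib, ← smul_add, e3]
    simp only [smul_ite, smul_zero, Finset.sum_ite_eq', Finset.mem_univ, if_true, smul_smul]
    rw [← Finset.sum_smul, ← Finset.sum_mul, EuclideanSpace.real_norm_sq_eq]
    congr 1
    simp only [sq]
    ring
  rw [e1]
  exact smul_right_injective A (two_ne_zero (α := ℝ)) e4

/-- The Cauchy field with the kernel `‖y - x‖⁻ⁿ` replaced by the smooth kernel
`(‖y - x‖² + s)^(-n/2)`. -/
noncomputable def regularizedField (a b : Matrix (Fin n) (Fin q) A)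
    (f : EuclideanSpace ℝ (Fin n) → A) (x : EuclideanSpace ℝ (Fin n)) (s : ℝ)
    (y : EuclideanSpace ℝ (Fin n)) (j : Fin n) : A :=
  (‖y - x‖ ^ 2 + s) ^ (-((n : ℝ) / 2)) • (f y * kernelForm a b j (y - x))

theorem cauchyField_eq (f : EuclideanSpace ℝ (Fin n) → A) (x y : EuclideanSpace ℝ (Fin n))
    (j : Fin n) :
    cauchyField a b f x y j = (‖y - x‖ ^ n)⁻¹ • (f y * kernelForm a b j (y - x)) := by
  rw [cauchyField, kernelForm_eq]
  simp only [mul_smul_comm, ← Finset.smul_sum]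

variable {D : Set (EuclideanSpace ℝ (Fin n))} {f : EuclideanSpace ℝ (Fin n) → A}
  {x : EuclideanSpace ℝ (Fin n)} {s : ℝ}

theorem contDiffOn_regularizedField (hs : 0 < s) (hf : ContDiffOn ℝ 1 f D) (j : Fin n) :
    ContDiffOn ℝ 1 (fun y => regularizedField a b f x s y j) D := by
  have h1 : ContDiff ℝ 1 fun y : EuclideanSpace ℝ (Fin n) =>
      (‖y - x‖ ^ 2 + s) ^ (-((n : ℝ) / 2)) := by
    refine ContDiff.rpow_const_of_ne ?_ fun y => (by positivity : (0 : ℝ) < _).ne'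
    exact ((contDiff_id.sub contDiff_const).norm_sq ℝ).add contDiff_const
  refine h1.contDiffOn.smul (hf.mul ?_)
  exact ((kernelForm a b j).contDiff.comp (contDiff_id.sub contDiff_const)).contDiffOn

/-- The divergence of the regularized field is the value of `f` times an approximate identity. -/
theorem divergence_regularizedField (hn : 0 < n) (hab : SolvesKernelSystem a b) (hs : 0 < s)
    {z : EuclideanSpace ℝ (Fin n)} (hf : DifferentiableAt ℝ f z)
    (hC : ∀ m, ∑ j, fderiv ℝ f z (EuclideanSpace.single j 1) * a j m = 0) :
    ∑ j, fderiv ℝ (fun y => regularizedField a b f x s y j) z (EuclideanSpace.single j 1)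
      = ((ballVol n)⁻¹ * (s * (‖z - x‖ ^ 2 + s) ^ (-((n : ℝ) / 2) - 1))) • f z := by
  have hn' : (n : ℝ) ≠ 0 := by positivity
  have hV := (ballVol_pos n).ne'
  set N := ‖z - x‖ ^ 2 + s with hN
  have hN0 : 0 < N := by positivity
  set h := N ^ (-((n : ℝ) / 2)) with hh
  set h' := N ^ (-((n : ℝ) / 2) - 1) with hh'
  have hhN : h = N * h' := by rw [hh, hh', Real.rpow_sub_one hN0.ne']; field_simp
  have hsub : HasFDerivAt (fun y : EuclideanSpace ℝ (Fin n) => y - x)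
      (ContinuousLinearMap.id ℝ _) z := (hasFDerivAt_id z).sub_const x
  -- the three terms come from the weight, from `f`, and from the linear form; the second one is
  -- killed by the Cauchy conditions
  have hterm : ∀ j, fderiv ℝ (fun y => regularizedField a b f x s y j) z
      (EuclideanSpace.single j 1)
      = -((n : ℝ) * h') • (f z * ((z - x) j • kernelForm a b j (z - x)))
        + h • (fderiv ℝ f z (EuclideanSpace.single j 1) * kernelForm a b j (z - x))
        + (h * ((n : ℝ) * ballVol n)⁻¹) • f z := by
    intro j
    have d1 := ((hsub.norm_sq.add_const s).rpow_const (p := -((n : ℝ) / 2)) (Or.inl hN0.ne'))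
    have d2 := hf.hasFDerivAt.mul ((kernelForm a b j).hasFDerivAt.comp z hsub)
    have d3 := d1.smul d2
    have d4 : HasFDerivAt (fun y => regularizedField a b f x s y j) _ z := d3
    rw [d4.fderiv]
    have hk := kernelForm_single hab j
    simp only [_root_.add_apply, _root_.smul_apply, ContinuousLinearMap.smulRight_apply,
      ContinuousLinearMap.comp_apply, ContinuousLinearMap.id_apply, hk, innerSL_apply_apply,
      Function.comp_apply, EuclideanSpace.inner_single_right]
    rw [← hN, ← hh, ← hh']
    rw [Pi.mul_apply, Function.comp_apply, conj_trivial, one_mul, smul_eq_mul, smul_eq_mul,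
      mul_smul_comm, mul_one, mul_smul_comm, mul_comm (kernelForm a b j (z - x)) (fderiv ℝ f z _)]
    module
  have hsum2 : ∑ j, fderiv ℝ f z (EuclideanSpace.single j 1) * kernelForm a b j (z - x) = 0 := by
    simp only [kernelForm_eq, Finset.mul_sum]
    rw [Finset.sum_comm]
    refine Finset.sum_eq_zero fun m _ => ?_
    simp only [← mul_assoc]
    rw [← Finset.sum_mul, hC m, zero_mul]
  simp only [hterm, Finset.sum_add_distrib, ← Finset.smul_sum, ← Finset.mul_sum, hsum2,
    sum_smul_kernelForm hab, smul_zero, add_zero, Finset.sum_const, Finset.card_univ,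
    Fintype.card_fin]
  rw [mul_smul_comm, mul_one, ← Nat.cast_smul_eq_nsmul ℝ, smul_smul, smul_smul, ← add_smul, hhN, hN]
  congr 1
  field_simp
  ring

end Kernel

/-! ### The Cauchy formula -/

section CauchyFormula

open Filter Topology

variable {n q : ℕ} {A : Type*} [NormedCommRing A] [NormedAlgebra ℝ A]
  {a b : Matrix (Fin n) (Fin q) A} {D : Set (EuclideanSpace ℝ (Fin n))}
  {f : EuclideanSpace ℝ (Fin n) → A} {x : EuclideanSpace ℝ (Fin n)}

/-- The flux density of `f(y) ∑ m, a^j_m φ_m(x, y)`, without the factor `‖y - x‖⁻ⁿ`. -/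
noncomputable def numeratorFlux (a b : Matrix (Fin n) (Fin q) A)
    (D : Set (EuclideanSpace ℝ (Fin n))) (f : EuclideanSpace ℝ (Fin n) → A)
    (x y : EuclideanSpace ℝ (Fin n)) : A :=
  ∑ j, outwardUnitNormal D y j • (f y * kernelForm a b j (y - x))

theorem boundaryFlux_cauchyField (y : EuclideanSpace ℝ (Fin n)) :
    boundaryFlux D (cauchyField a b f x) y = (‖y - x‖ ^ n)⁻¹ • numeratorFlux a b D f x y := by
  simp only [boundaryFlux, numeratorFlux, cauchyField_eq, Finset.smul_sum]
  exact Finset.sum_congr rfl fun j _ => smul_comm _ _ _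

theorem boundaryFlux_regularizedField (s : ℝ) (y : EuclideanSpace ℝ (Fin n)) :
    ∑ j, outwardUnitNormal D y j • regularizedField a b f x s y j
      = (‖y - x‖ ^ 2 + s) ^ (-((n : ℝ) / 2)) • numeratorFlux a b D f x y := by
  simp only [numeratorFlux, regularizedField, Finset.smul_sum]
  exact Finset.sum_congr rfl fun j _ => smul_comm _ _ _

theorem continuousOn_numeratorFlux (hs : HasSmoothBoundary D) (hf : ContinuousOn f (closure D)) :
    ContinuousOn (numeratorFlux a b D f x) (frontier D) := by
  refine continuousOn_finsetSum _ fun j _ => ContinuousOn.smul ?_ (ContinuousOn.mul ?_ ?_)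
  · exact (EuclideanSpace.proj (𝕜 := ℝ) j).continuous.comp_continuousOn
      (continuousOn_outwardUnitNormal hs)
  · exact hf.mono frontier_subset_closure
  · exact ((kernelForm a b j).continuous.comp (continuous_id.sub continuous_const)).continuousOn

theorem norm_sub_pos_of_mem_frontier (hD : IsOpen D) (hx : x ∈ D)
    {y : EuclideanSpace ℝ (Fin n)} (hy : y ∈ frontier D) : 0 < ‖y - x‖ := by
  rw [hD.frontier_eq] at hy
  exact norm_pos_iff.2 (sub_ne_zero.2 fun h => hy.2 (h ▸ hx))

theorem rpow_norm_sq (n : ℕ) (z : EuclideanSpace ℝ (Fin n)) :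
    (‖z‖ ^ 2) ^ (-((n : ℝ) / 2)) = (‖z‖ ^ n)⁻¹ := by
  rw [Real.rpow_neg (by positivity), ← Real.rpow_natCast ‖z‖ 2, ← Real.rpow_mul (norm_nonneg _),
    ← Real.rpow_natCast]
  congr 2
  push_cast
  ring

theorem integrable_boundaryFlux_cauchyField (hD : IsOpen D) (hb : Bornology.IsBounded D)
    (hs : HasSmoothBoundary D) (hf : ContinuousOn f (closure D)) (hx : x ∈ D) :
    Integrable (boundaryFlux D (cauchyField a b f x)) (surfaceMeasure D) := by
  refine integrable_surfaceMeasure hD hb hs ?_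
  refine (((ContinuousOn.inv₀ ?_ ?_).smul (continuousOn_numeratorFlux (a := a) (b := b) (x := x)
    hs hf)).congr fun y _ => boundaryFlux_cauchyField y)
  · exact (continuous_id.sub continuous_const).norm.pow n |>.continuousOn
  · exact fun y hy => (pow_pos (norm_sub_pos_of_mem_frontier hD hx hy) n).ne'

/-- The boundary integrals of the regularized fields converge. -/
theorem tendsto_integral_regularized (hD : IsOpen D) (hb : Bornology.IsBounded D)
    (hs : HasSmoothBoundary D) (hf : ContinuousOn f (closure D)) (hx : x ∈ D) :
    Tendsto (fun c : ℝ => ∫ y, ∑ j, outwardUnitNormal D y j •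
        regularizedField a b f x (c⁻¹ ^ 2) y j ∂(surfaceMeasure D)) atTop
      (𝓝 (∫ y, boundaryFlux D (cauchyField a b f x) y ∂(surfaceMeasure D))) := by
  have hae : ∀ᵐ y ∂(surfaceMeasure D), y ∈ frontier D :=
    ae_restrict_mem isClosed_frontier.measurableSet
  have hnum := continuousOn_numeratorFlux (a := a) (b := b) (x := x) hs hf
  refine tendsto_integral_filter_of_dominated_convergence
    (fun y => ‖boundaryFlux D (cauchyField a b f x) y‖) ?_ ?_
    (integrable_boundaryFlux_cauchyField hD hb hs hf hx).norm ?_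
  · filter_upwards [eventually_gt_atTop 0] with c hc
    simp only [boundaryFlux_regularizedField]
    refine (integrable_surfaceMeasure hD hb hs (ContinuousOn.smul ?_ hnum)).aestronglyMeasurable
    refine Continuous.continuousOn (Continuous.rpow_const ?_ fun y => Or.inl ?_)
    · exact ((continuous_id.sub continuous_const).norm.pow 2).add continuous_const
    · positivity
  · filter_upwards with c
    filter_upwards [hae] with y hy
    have h0 := norm_sub_pos_of_mem_frontier hD hx hy
    rw [boundaryFlux_regularizedField, boundaryFlux_cauchyField, norm_smul, norm_smul,
      ← rpow_norm_sq, Real.norm_of_nonneg (by positivity), Real.norm_of_nonneg (by positivity)]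
    refine mul_le_mul_of_nonneg_right ?_ (norm_nonneg _)
    exact Real.rpow_le_rpow_of_nonpos (by positivity) (le_add_of_nonneg_right (by positivity))
      (by have : (0 : ℝ) ≤ n := by positivity
          linarith)
  · filter_upwards [hae] with y hy
    have h0 := norm_sub_pos_of_mem_frontier hD hx hy
    simp only [boundaryFlux_regularizedField, boundaryFlux_cauchyField, ← rpow_norm_sq]
    refine Tendsto.smul_const ?_ _
    have h1 : Tendsto (fun c : ℝ => ‖y - x‖ ^ 2 + c⁻¹ ^ 2) atTop (𝓝 (‖y - x‖ ^ 2 + 0 ^ 2)) :=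
      (tendsto_inv_atTop_zero.pow 2).const_add _
    rw [zero_pow two_ne_zero, add_zero] at h1
    exact h1.rpow_const (Or.inl (by positivity))

/-- The Cauchy formula, by comparing the limits of both sides of the divergence theorem for the
regularized fields. -/
theorem eq_integral_boundaryFlux [CompleteSpace A] (hn : 0 < n)
    (hab : SolvesKernelSystem a b) (hD : IsOpen D) (hb : Bornology.IsBounded D)
    (hs : HasSmoothBoundary D) (hf : ContDiffOn ℝ 1 f (closure D))
    (hC : SatisfiesCauchyConditions a D f) (hx : x ∈ D) :
    f x = ∫ y, boundaryFlux D (cauchyField a b f x) y ∂(surfaceMeasure D) := by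
  have hbdry := tendsto_integral_regularized (a := a) (b := b) hD hb hs hf.continuousOn hx
  have hfi : Integrable (D.indicator f) := (integrable_indicator_iff hD.measurableSet).2
    ((hf.continuousOn.integrableOn_compact hb.isCompact_closure).mono_set subset_closure)
  have hfc : ContinuousAt (D.indicator f) x := by
    refine ((hf.continuousOn.mono subset_closure).continuousAt (hD.mem_nhds hx)).congr ?_
    exact Filter.eventually_of_mem (hD.mem_nhds hx) fun y hy => (Set.indicator_of_mem hy f).symm
  have hint := tendsto_integral_comp_smul_smul_of_integrable' (φ := peak n) (peak_nonneg n)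
    (integral_peak hn) (by simpa using tendsto_norm_pow_mul_peak n) hfi hfc
  rw [Set.indicator_of_mem hx] at hint
  refine tendsto_nhds_unique hint (hbdry.congr' ?_)
  filter_upwards [eventually_gt_atTop 0] with c hc
  have hc2 : 0 < c⁻¹ ^ 2 := by positivity
  rw [← integral_divergence_eq_integral_flux hD hb hs
    fun j => contDiffOn_regularizedField (a := a) (b := b) (x := x) hc2 hf j,
    ← integral_indicator hD.measurableSet]
  refine integral_congr_ae (Filter.Eventually.of_forall fun z => ?_)
  simp only
  by_cases hz : z ∈ D
  · rw [Set.indicator_of_mem hz, Set.indicator_of_mem hz,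
      divergence_regularizedField hn hab hc2 (differentiableAt_of_contDiffOn_closure hD hf hz)
        fun m => hC m z hz, finrank_euclideanSpace_fin, pow_mul_peak_smul hc, norm_sub_rev]
  · rw [Set.indicator_of_notMem hz, Set.indicator_of_notMem hz, smul_zero]

end CauchyFormula

end CauchyAlgebra

theorem mainTheorem1 {A : Type*} [NormedCommRing A] [NormedAlgebra ℝ A] [FiniteDimensional ℝ A]
    {q r : ℕ} (hn : 0 < q + r) (a : Matrix (Fin (q + r)) (Fin q) A)
    (hD₀ : IsUnit (CauchyAlgebra.detMain a)) (hA : CauchyAlgebra.ConditionA a) :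
    (∃ c : Matrix (Fin q) (Fin q) A, CauchyAlgebra.IsAdmissible (q + r) c) ∧
    (∀ b : Matrix (Fin (q + r)) (Fin q) A, CauchyAlgebra.SolvesKernelSystem a b ↔
      ∃ c : Matrix (Fin q) (Fin q) A,
        CauchyAlgebra.IsAdmissible (q + r) c ∧ b = CauchyAlgebra.cramerCoeff a c) ∧
    (∀ c : Matrix (Fin q) (Fin q) A, CauchyAlgebra.IsAdmissible (q + r) c →
      CauchyAlgebra.IsAdmissible (q + r) (CauchyAlgebra.extendedCoeff a c) ∧
      (∀ i j, ∑ m, a j m * CauchyAlgebra.cramerCoeff a c i m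
        = (CauchyAlgebra.ballVol (q + r))⁻¹ • CauchyAlgebra.extendedCoeff a c j i) ∧
      ∀ D : Set (EuclideanSpace ℝ (Fin (q + r))), IsOpen D → Bornology.IsBounded D →
        CauchyAlgebra.HasSmoothBoundary D →
      ∀ f : EuclideanSpace ℝ (Fin (q + r)) → A, ContDiffOn ℝ 1 f (closure D) →
        CauchyAlgebra.SatisfiesCauchyConditions a D f →
      ∀ x ∈ D,
        MeasureTheory.Integrable (CauchyAlgebra.boundaryFlux D
          (CauchyAlgebra.cauchyField a (CauchyAlgebra.cramerCoeff a c) f x))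
          (CauchyAlgebra.surfaceMeasure D) ∧
        f x = ∫ y, CauchyAlgebra.boundaryFlux D
          (CauchyAlgebra.cauchyField a (CauchyAlgebra.cramerCoeff a c) f x) y
          ∂(CauchyAlgebra.surfaceMeasure D)) := by
  have : CompleteSpace A := FiniteDimensional.complete ℝ A
  refine ⟨⟨_, CauchyAlgebra.isAdmissible_scalar _ _⟩,
    CauchyAlgebra.solvesKernelSystem_iff hA hD₀, fun c hc =>
    ⟨hc.extendedCoeff hA hD₀, CauchyAlgebra.sum_mul_cramerCoeff hD₀ c, ?_⟩⟩
  intro D hD hb hs f hf hC x hx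
  exact ⟨CauchyAlgebra.integrable_boundaryFlux_cauchyField hD hb hs hf.continuousOn hx,
    CauchyAlgebra.eq_integral_boundaryFlux hn
      ((CauchyAlgebra.solvesKernelSystem_iff hA hD₀ _).2 ⟨c, hc, rfl⟩) hD hb hs hf hC hx⟩
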